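/- Let $M$ be an open Riemann surface, i.e. a connected non-compact Hausdorff one-dimensional complex manifold (without boundary). Call $M$ hyperbolic if it carries a negative non-constant subharmonic function, and parabolic otherwise. Write $\mathbb S^1=\{v\in\mathbb C:|v|=1\}$. (a) Let $F=(F_1,F_2):M\to\mathbb C^2$ be a holomorphic map such that the map $$\Psi:\mathbb S^1\times M\to\mathbb R^2,\qquad \Psi(v,P)=\mathrm{Re}\big(vF(P)\big)=\big(\mathrm{Re}(vF_1(P)),\mathrm{Re}(vF_2(P))\big),$$ is proper. Then $F_1,F_2:M\to\mathbb C$ are proper and $M$ is parabolic. If in addition $M$ has finite topology (that is, $M$ is homeomorphic to a compact surface without boundary with a finite set of points removed), then there are a compact connected Riemann surface $S$, a finite set $Q\subset S$ and a biholomorphism $\Phi:M\to S\setminus Q$ such that, for $j=1,2$, the function $F_j\circ\Phi^{-1}:S\setminus Q\to\mathbb C$ extends to a meromorphic function on $S$. (b) If $M$ is hyperbolic, then $\mathbb S^1$ is not a projector set for $M$. Here a closed set $Z\subset\mathbb S^1$ is called a projector set for $M$ if there is a null holomorphic curve $F=(F_1,F_2,F_3):M\to\mathbb C^3$ (a holomorphic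 map such that $\sum_{j}(dF_j)^2=0$ and $\sum_j|dF_j|^2$ vanishes nowhere) for which the map $Z\times M\to\mathbb R^2$, $(v,P)\mapsto\mathrm{Re}\big(v(F_1,F_2)(P)\big)$, is proper. -/

import Mathlib

open scoped Manifold ContDiff

universe u

/-- `u : M → [-∞, ∞)` is subharmonic on the Riemann surface `M`: it is upper semicontinuous, never
`+∞`, and, in every chart, it satisfies the sub-mean value inequality
`u (c) ≤ (1 / 2π) ∫ u (c + r e^{iθ}) dθ` on every closed disc contained in the range of the chart.
The integral of an upper semicontinuous function with values in `[-∞, ∞)` over a circle is the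
infimum of the integrals of the continuous real functions `φ` that lie above it; hence the
inequality says that `u (c)` is at most the circle average of each such `φ`. -/
def IsSubharmonic {M : Type*} [TopologicalSpace M] [ChartedSpace ℂ M] (u : M → EReal) : Prop :=
  UpperSemicontinuous u ∧ (∀ p, u p < ⊤) ∧
    ∀ e ∈ atlas ℂ M, ∀ (c : ℂ) (r : ℝ), 0 < r → Metric.closedBall c r ⊆ e.target →
      ∀ φ : ℂ → ℝ, ContinuousOn φ (Metric.sphere c r) →
        (∀ z ∈ Metric.sphere c r, u (e.symm z) ≤ (φ z : EReal)) →
        u (e.symm c) ≤ ((Real.circleAverage φ c r : ℝ) : EReal)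

/-- An open Riemann surface is hyperbolic if it carries a negative non-constant subharmonic
function. -/
def IsHyperbolic (M : Type*) [TopologicalSpace M] [ChartedSpace ℂ M] : Prop :=
  ∃ u : M → EReal, IsSubharmonic u ∧ (∀ p, u p < 0) ∧ ∃ p q, u p ≠ u q

/-- An open Riemann surface is parabolic if it is not hyperbolic: every negative subharmonic
function on it is constant. -/
def IsParabolic (M : Type*) [TopologicalSpace M] [ChartedSpace ℂ M] : Prop :=
  ¬ IsHyperbolic M

/-- A surface has finite topology if it is homeomorphic to a compact topological surface (without
boundary) with a finite set of points removed. -/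
def HasFiniteTopology (M : Type u) [TopologicalSpace M] : Prop :=
  ∃ (S : Type u) (_ : TopologicalSpace S) (_ : ChartedSpace (EuclideanSpace ℝ (Fin 2)) S)
    (_ : T2Space S) (_ : CompactSpace S) (Q : Set S),
    Q.Finite ∧ Nonempty (M ≃ₜ (Qᶜ : Set S))

/-- `g` is a meromorphic function on the Riemann surface `S` (its values at the poles are
irrelevant). -/
def IsMeromorphicFun {S : Type*} [TopologicalSpace S] [ChartedSpace ℂ S] (g : S → ℂ) : Prop :=
  ∀ p : S, MeromorphicAt (g ∘ (chartAt ℂ p).symm) (chartAt ℂ p p)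

/-- The map `(v, P) ↦ Re (v (F_1, F_2) (P))` from `Z × M` to `ℝ²`, for `Z` a subset of the unit
circle and a map `F : M → ℂ²`. -/
def rotatedRealPart {M : Type*} (Z : Set Circle) (F : M → Fin 2 → ℂ) :
    Z × M → Fin 2 → ℝ :=
  fun x j => (((x.1 : Circle) : ℂ) * F x.2 j).re

/-- The differential `df_p (w)` of a function `f : M → ℂ`, as a complex number. -/
noncomputable def holoDifferential {M : Type*} [TopologicalSpace M] [ChartedSpace ℂ M]
    (f : M → ℂ) (p : M) (w : TangentSpace 𝓘(ℂ) p) : ℂ :=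
  mfderiv 𝓘(ℂ) 𝓘(ℂ) f p w

/-- Null holomorphic curves in `ℂ³`: holomorphic maps `F` such that `∑ (dF_j)² = 0` and
`∑ |dF_j|²` vanishes nowhere. -/
def IsNullCurve {M : Type*} [TopologicalSpace M] [ChartedSpace ℂ M] (F : M → Fin 3 → ℂ) : Prop :=
  MDifferentiable 𝓘(ℂ) 𝓘(ℂ, Fin 3 → ℂ) F ∧
    ∀ (p : M) (w : TangentSpace 𝓘(ℂ) p), w ≠ 0 →
      ∑ j, holoDifferential (fun P => F P j) p w ^ 2 = 0 ∧
      ∑ j, ‖holoDifferential (fun P => F P j) p w‖ ^ 2 ≠ 0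

/-- A closed subset `Z` of the unit circle is a projector set for the open Riemann surface `M` if
there is a null curve `F : M → ℂ³` for which `(v, P) ↦ Re (v (F_1, F_2) (P))` is proper on
`Z × M`. -/
def IsProjectorSet (M : Type*) [TopologicalSpace M] [ChartedSpace ℂ M] (Z : Set Circle) : Prop :=
  IsClosed Z ∧ ∃ F : M → Fin 3 → ℂ, IsNullCurve F ∧
    IsProperMap (rotatedRealPart Z (fun P => ![F P 0, F P 1]))

/-!
If `Re (v F)` is proper on `Circle × M`, then each component `F j` is proper: at a point where
`F j` is bounded, some rotation `v` annihilates the real part of the other component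
(`isProperMap_of_rotatedRealPart`).

A surface with a proper holomorphic function `f` is parabolic (`isParabolic_of_isProperMap`):
outside a compact set `‖f‖ ≤ R`, a negative subharmonic function lies below `m + ε log (‖f‖ / R)`
for every `ε > 0`, where `m` is its maximum on the compact set. Hence it attains its maximum and is
constant. This also gives the statement about projector sets.

The remaining claim says that a Riemann surface `M` of finite topology with a proper holomorphic
function `f` has a complex structure across each point `q` that has to be added to make it compact.
The compact surface is the given topological one, so only charts at the added points are needed.
Near `q` there is a topological disc, in which the complex structure of `M` is a holomorphic atlas
of the punctured disc, and `h = 1 / f` is a holomorphic function that tends to zero at the puncture.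
No uniformization is needed; winding numbers in the topological disc suffice. Every holomorphic
chart has the same nonzero winding number `o` about its centre
(`IsHolomorphicAtlas.exists_hasLogIndex`), so the argument principle for continuous functions
(`exists_sum_hasLogIndex_eq`) shows that a holomorphic function `k` whose only zero is the puncture
takes each small nonzero value exactly `d / o` times, with multiplicities, where `d` is its
winding number about the puncture (`HolomorphicInCharts.exists_sum_mul_eq`). In particular `d ≠ 0`.
Now `h` has a root `k` of order `|d|` on the punctured disc, whose winding number is `1` or `-1`.
It takes each small value exactly once, hence it is a chart at the puncture
(`HolomorphicInCharts.exists_chart_at_puncture`). In this chart the proper holomorphic functions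
have isolated singularities at which they tend to infinity, that is, poles.
-/

open Complex Metric Set Filter Topology

/-! ### Continuous logarithms and winding numbers -/

theorem Convex.exists_continuousOn_log {U : Set ℂ} (hU : Convex ℝ U) (hUo : IsOpen U)
    (hne : U.Nonempty) {G : ℂ → ℂ} (hG : ContinuousOn G U) (h0 : ∀ z ∈ U, G z ≠ 0) :
    ∃ L : ℂ → ℂ, ContinuousOn L U ∧ ∀ z ∈ U, G z = exp (L z) := by
  have : ContractibleSpace U := hU.contractibleSpace hne
  have hsc : IsSimplyConnected U := SimplyConnectedSpace.ofContractible U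
  obtain ⟨L, hL, hLe⟩ := exists_continuousOn_eqOn_exp_comp hsc hUo hG
    (by rintro ⟨z, hz, hz0⟩; exact h0 z hz hz0)
  exact ⟨L, hL, fun z hz => (hLe hz).symm⟩

theorem IsPreconnected.eq_of_exp_eq_one {X : Type*} [TopologicalSpace X] {S : Set X}
    (hS : IsPreconnected S) {f : X → ℂ} (hf : ContinuousOn f S) (h : ∀ x ∈ S, exp (f x) = 1)
    {x y : X} (hx : x ∈ S) (hy : y ∈ S) : f x = f y := by
  have : DiscreteTopology (AddSubgroup.zmultiples (2 * Real.pi * I) : Set ℂ) :=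
    NormedSpace.discreteTopology_zmultiples _
  refine hS.constant_of_mapsTo (T := (AddSubgroup.zmultiples (2 * Real.pi * I) : Set ℂ))
    ⟨this⟩ hf (fun x hx => ?_) hx hy
  obtain ⟨n, hn⟩ := exp_eq_one_iff.1 (h x hx)
  exact AddSubgroup.mem_zmultiples_iff.2 ⟨n, by rw [hn, zsmul_eq_mul]⟩

/-- A power `(z - p) ^ m` with `m ≠ 0` has no continuous logarithm on a circle about `p`. -/
theorem eq_zero_of_zpow_eq_exp_on_sphere {p : ℂ} {s : ℝ} (hs : 0 < s) {m : ℤ} {L : ℂ → ℂ}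
    (hL : ContinuousOn L (sphere p s)) (h : ∀ z ∈ sphere p s, (z - p) ^ m = exp (L z)) :
    m = 0 := by
  set D : ℝ → ℂ := fun θ => L (circleMap p s θ) - m * (Real.log s + θ * I) with hD
  have hc : Continuous fun θ : ℝ => L (circleMap p s θ) :=
    hL.comp_continuous (continuous_circleMap p s) fun θ => circleMap_mem_sphere p hs.le θ
  have hDc : Continuous D := hc.sub (by fun_prop)
  have hexp : ∀ θ ∈ (univ : Set ℝ), exp (D θ) = 1 := by
    intro θ _
    have h1 := h _ (circleMap_mem_sphere p hs.le θ)
    have h2 : circleMap p s θ - p = exp (Real.log s + θ * I) := by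
      rw [exp_add, ← ofReal_exp, Real.exp_log hs]; simp [circleMap]
    rw [hD]
    simp only
    rw [exp_sub, ← h1, h2, ← exp_int_mul, div_self (exp_ne_zero _)]
  have heq := isPreconnected_univ.eq_of_exp_eq_one hDc.continuousOn hexp
    (mem_univ (0 : ℝ)) (mem_univ (2 * Real.pi))
  simp only [hD] at heq
  have hper : circleMap p s (2 * Real.pi) = circleMap p s 0 := by
    simpa using periodic_circleMap p s 0
  rw [hper] at heq
  have h3 : (m : ℂ) * (2 * Real.pi * I) = 0 := by
    have := sub_eq_zero.2 heq
    push_cast at this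
    linear_combination this
  rcases mul_eq_zero.1 h3 with h4 | h4
  · exact_mod_cast h4
  · exact absurd h4 two_pi_I_ne_zero

/-- Continuous nonvanishing functions on a punctured disc are `(z - p) ^ w * exp L`. -/
theorem exists_zpow_mul_exp_on_punctured_ball {p : ℂ} {r : ℝ} (hr : 0 < r) {G : ℂ → ℂ}
    (hG : ContinuousOn G (ball p r \ {p})) (h0 : ∀ z ∈ ball p r \ {p}, G z ≠ 0) :
    ∃ (w : ℤ) (L : ℂ → ℂ), ContinuousOn L (ball p r \ {p}) ∧
      ∀ z ∈ ball p r \ {p}, G z = (z - p) ^ w * exp (L z) := by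
  set U : Set ℂ := {w | w.re < Real.log r} with hU
  have hUo : IsOpen U := isOpen_lt continuous_re continuous_const
  have hUc : Convex ℝ U := convex_halfSpace_re_lt _
  have hUne : U.Nonempty := ⟨((Real.log r - 1 : ℝ) : ℂ), by simp [hU]⟩
  have hmap : ∀ w ∈ U, p + exp w ∈ ball p r \ {p} := by
    intro w hw
    refine ⟨?_, by simp⟩
    rw [mem_ball, dist_eq, add_sub_cancel_left, norm_exp]
    exact (Real.lt_log_iff_exp_lt hr).1 hw
  have hlogU : ∀ z ∈ ball p r \ {p}, ∀ w, exp w = z - p → w ∈ U := by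
    rintro z ⟨hz, -⟩ w hw
    rw [mem_ball, dist_eq, ← hw, norm_exp] at hz
    exact (Real.lt_log_iff_exp_lt hr).2 hz
  obtain ⟨l, hlc, hl⟩ := hUc.exists_continuousOn_log hUo hUne
    (G := fun w => G (p + exp w)) (hG.comp (by fun_prop) hmap) (fun w hw => h0 _ (hmap w hw))
  have hsh : ∀ w ∈ U, w + 2 * Real.pi * I ∈ U := by intro w hw; simpa [hU] using hw
  obtain ⟨w0, hw0⟩ := hUne
  have hone : ∀ w ∈ U, exp (l (w + 2 * Real.pi * I) - l w) = 1 := by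
    intro w hw
    rw [exp_sub, ← hl w hw, ← hl _ (hsh w hw), exp_periodic w, div_self (h0 _ (hmap w hw))]
  obtain ⟨m, hm⟩ := exp_eq_one_iff.1 (hone w0 hw0)
  have hconst : ∀ w ∈ U, l (w + 2 * Real.pi * I) - l w = m * (2 * Real.pi * I) := by
    intro w hw
    rw [← hm]
    refine hUc.isPreconnected.eq_of_exp_eq_one
      (f := fun w => l (w + 2 * Real.pi * I) - l w) ?_ hone hw hw0
    exact (hlc.comp (by fun_prop) hsh).sub hlc
  set H : ℂ → ℂ := fun w => l w - m * w with hH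
  have hper : ∀ k : ℤ, ∀ w ∈ U, H (w + k * (2 * Real.pi * I)) = H w := by
    have hone : ∀ w ∈ U, H (w + 2 * Real.pi * I) = H w := by
      intro w hw
      simp only [hH]
      linear_combination hconst w hw
    have hsub : ∀ k : ℤ, ∀ w ∈ U, w + k * (2 * Real.pi * I) ∈ U := by
      intro k w hw; simpa [hU] using hw
    intro k
    induction k using Int.induction_on with
    | zero => simp
    | succ k ih =>
      intro w hw
      rw [← ih w hw, ← hone _ (hsub k w hw)]
      congr 1; push_cast; ring
    | pred k ih =>
      intro w hw
      rw [← ih w hw, ← hone _ (hsub _ w hw)]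
      congr 1; push_cast; ring
  have hHbr : ∀ w ∈ U, H (log (exp w)) = H w := by
    intro w hw
    obtain ⟨k, hk⟩ := exp_eq_exp_iff_exists_int.1 (exp_log (exp_ne_zero w))
    rw [hk, hper k w hw]
  refine ⟨m, fun z => H (log (z - p)), ?_, ?_⟩
  · intro z0 hz0
    have hz0' : z0 - p ≠ 0 := sub_ne_zero.2 hz0.2
    -- A branch of `log (z - p)` that is continuous at `z0`.
    set b : ℂ → ℂ := fun z => log ((z - p) / (z0 - p)) + log (z0 - p) with hb
    have hbc : ContinuousAt b z0 := by
      refine ContinuousAt.add (ContinuousAt.clog (by fun_prop) ?_) continuousAt_const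
      rw [div_self hz0']; exact one_mem_slitPlane
    have hbe : ∀ z ∈ ball p r \ {p}, exp (b z) = z - p := by
      intro z hz
      have : z - p ≠ 0 := sub_ne_zero.2 hz.2
      rw [hb]; simp only
      rw [exp_add, exp_log (div_ne_zero this hz0'), exp_log hz0', div_mul_cancel₀ _ hz0']
    have hbU : b z0 ∈ U := hlogU z0 hz0 _ (hbe z0 hz0)
    have hHc : ContinuousAt H (b z0) := by
      have := hlc.continuousAt (hUo.mem_nhds hbU)
      fun_prop
    have hcomp : ContinuousAt (fun z => H (b z)) z0 := ContinuousAt.comp hHc hbc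
    refine hcomp.continuousWithinAt.congr (fun z hz => ?_) ?_
    · rw [← hbe z hz, hHbr _ (hlogU z hz _ (hbe z hz))]
    · rw [← hbe z0 hz0, hHbr _ (hlogU z0 hz0 _ (hbe z0 hz0))]
  · intro z hz
    have hz' : z - p ≠ 0 := sub_ne_zero.2 hz.2
    have hu := hlogU z hz _ (exp_log hz')
    have h1 := hl _ hu
    rw [exp_log hz', add_sub_cancel] at h1
    rw [h1, hH]
    simp only
    rw [exp_sub, exp_int_mul, exp_log hz', mul_div_cancel₀ _ (zpow_ne_zero _ hz')]

/-- Decomposition of a continuous function that is nonvanishing on a disc minus a finite set. -/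
theorem exists_prod_zpow_mul_exp {c : ℂ} {r : ℝ} (hr : 0 < r) (Z : Finset ℂ) :
    ∀ {G : ℂ → ℂ}, (∀ q ∈ Z, q ∈ ball c r) → ContinuousOn G (ball c r \ Z) →
    (∀ z ∈ ball c r \ Z, G z ≠ 0) →
    ∃ (w : ℂ → ℤ) (L : ℂ → ℂ), ContinuousOn L (ball c r \ Z) ∧
      ∀ z ∈ ball c r \ Z, G z = (∏ q ∈ Z, (z - q) ^ w q) * exp (L z) := by
  classical
  induction Z using Finset.induction_on with
  | empty =>
    intro G _ hG h0
    simp only [Finset.coe_empty, sdiff_empty] at hG h0 ⊢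
    obtain ⟨L, hL, h⟩ := (convex_ball c r).exists_continuousOn_log isOpen_ball
      ⟨c, mem_ball_self hr⟩ hG h0
    exact ⟨0, L, hL, by simpa using h⟩
  | insert q Z hqZ ih =>
    intro G hZ hG h0
    have hopen : IsOpen (ball c r \ (Z : Set ℂ)) :=
      isOpen_ball.sdiff Z.finite_toSet.isClosed
    have hopen' : IsOpen (ball c r \ (insert q Z : Finset ℂ)) :=
      isOpen_ball.sdiff (Finset.finite_toSet _).isClosed
    have hq : q ∈ ball c r \ (Z : Set ℂ) := ⟨hZ q (by simp), hqZ⟩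
    obtain ⟨δ, hδ, hδs⟩ := Metric.isOpen_iff.1 hopen q hq
    have hsub : ball q δ \ {q} ⊆ ball c r \ (insert q Z : Finset ℂ) := by
      rintro z ⟨hz, hzq⟩
      refine ⟨(hδs hz).1, ?_⟩
      have := (hδs hz).2
      simp at this hzq ⊢
      exact ⟨hzq, this⟩
    obtain ⟨m, l, hl, hle⟩ := exists_zpow_mul_exp_on_punctured_ball hδ (hG.mono hsub)
      (fun z hz => h0 z (hsub hz))
    -- Extend `l` continuously to the complement of `q` by a radial retraction.
    set ρ : ℂ → ℂ := fun z => q + (min 1 ((δ / 2) / ‖z - q‖) : ℝ) * (z - q) with hρ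
    have hρc : ContinuousOn ρ {q}ᶜ := by
      have : ∀ z ∈ ({q}ᶜ : Set ℂ), ‖z - q‖ ≠ 0 := by
        intro z hz; simpa [sub_eq_zero] using hz
      have h1 : ContinuousOn (fun z : ℂ => min 1 ((δ / 2) / ‖z - q‖)) {q}ᶜ :=
        continuousOn_const.inf (ContinuousOn.div (by fun_prop) (by fun_prop) this)
      have h2 : ContinuousOn (fun z : ℂ => ((min 1 ((δ / 2) / ‖z - q‖) : ℝ) : ℂ)) {q}ᶜ :=
        continuous_ofReal.comp_continuousOn h1
      exact continuousOn_const.add (h2.mul (by fun_prop))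
    have hρm : ∀ z ∈ ({q}ᶜ : Set ℂ), ρ z ∈ ball q δ \ {q} := by
      intro z hz
      have hpos : 0 < ‖z - q‖ := by simpa [sub_eq_zero] using hz
      have hmin : 0 < min 1 ((δ / 2) / ‖z - q‖) := lt_min one_pos (by positivity)
      constructor
      · rw [mem_ball, dist_eq, hρ]
        simp only [add_sub_cancel_left, norm_mul, norm_real, Real.norm_eq_abs]
        rw [abs_of_pos hmin]
        calc _ ≤ (δ / 2) / ‖z - q‖ * ‖z - q‖ := by gcongr; exact min_le_right _ _
          _ = δ / 2 := div_mul_cancel₀ _ hpos.ne'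
          _ < δ := by linarith
      · rw [mem_singleton_iff, hρ]
        simp only [add_eq_left, mul_eq_zero, not_or]
        exact ⟨by exact_mod_cast hmin.ne', by simpa using hpos.ne'⟩
    have hρeq : ∀ z ∈ ball q (δ / 2) \ {q}, ρ z = z := by
      rintro z ⟨hz, hzq⟩
      have hpos : 0 < ‖z - q‖ := by simpa [sub_eq_zero] using hzq
      rw [mem_ball, dist_eq] at hz
      have : min 1 ((δ / 2) / ‖z - q‖) = 1 := min_eq_left ((one_le_div hpos).2 hz.le)
      simp [hρ, this]
    have hL0c : ContinuousOn (fun z => l (ρ z)) {q}ᶜ := hl.comp hρc hρm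
    set G' : ℂ → ℂ := fun z => if z = q then 1 else G z * (z - q) ^ (-m) * exp (-l (ρ z)) with hG'
    have hG'1 : ∀ z ∈ ball q (δ / 2), G' z = 1 := by
      intro z hz
      by_cases hzq : z = q
      · simp [hG', hzq]
      · have h1 := hle z ⟨ball_subset_ball (by linarith) hz, hzq⟩
        have : z - q ≠ 0 := sub_ne_zero.2 hzq
        simp only [hG', if_neg hzq, hρeq z ⟨hz, hzq⟩, h1, exp_neg, zpow_neg]
        have := zpow_ne_zero m this
        have := exp_ne_zero (l z)
        field_simp
    have hmem : ∀ z ∈ ball c r \ (Z : Set ℂ), z ≠ q → z ∈ ball c r \ (insert q Z : Finset ℂ) := by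
      rintro z ⟨h1, h2⟩ h3
      refine ⟨h1, ?_⟩
      simp at h2 ⊢
      exact ⟨h3, h2⟩
    obtain ⟨w, L, hL, hLe⟩ := ih (G := G') (fun q hq => hZ q (by simp [hq]))
      (by
        intro z hz
        apply ContinuousAt.continuousWithinAt
        by_cases hzq : z = q
        · subst hzq
          refine (continuousAt_const (y := (1 : ℂ))).congr ?_
          filter_upwards [ball_mem_nhds z (half_pos hδ)] with x hx
          exact (hG'1 x hx).symm
        · have h1 : ContinuousAt G z := hG.continuousAt (hopen'.mem_nhds (hmem z hz hzq))
          have h2 : ContinuousAt (fun z => l (ρ z)) z :=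
            hL0c.continuousAt (isOpen_compl_singleton.mem_nhds hzq)
          have h3 : ContinuousAt (fun z => (z - q) ^ (-m)) z :=
            ContinuousAt.zpow₀ (by fun_prop) _ (Or.inl (sub_ne_zero.2 hzq))
          have h4 : ContinuousAt (fun z => G z * (z - q) ^ (-m) * exp (-l (ρ z))) z :=
            (h1.mul h3).mul h2.neg.cexp
          refine h4.congr ?_
          filter_upwards [isOpen_compl_singleton.mem_nhds hzq] with x hx
          simp only [mem_compl_iff, mem_singleton_iff] at hx
          simp [hG', hx])
      (by
        intro z hz
        by_cases hzq : z = q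
        · simp [hG', hzq]
        · simp only [hG', if_neg hzq]
          exact mul_ne_zero (mul_ne_zero (h0 z (hmem z hz hzq))
            (zpow_ne_zero _ (sub_ne_zero.2 hzq))) (exp_ne_zero _))
    refine ⟨Function.update w q m, fun z => L z + l (ρ z), ?_, ?_⟩
    · refine (hL.mono ?_).add (hL0c.mono ?_)
      · gcongr; simp
      · rintro z ⟨-, hz⟩; simp at hz; simpa using hz.1
    · rintro z ⟨hz, hz'⟩
      simp only [Finset.coe_insert, mem_insert_iff, not_or, Finset.mem_coe] at hz'
      have h1 := hLe z ⟨hz, by simpa using hz'.2⟩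
      simp only [hG', if_neg hz'.1] at h1
      have h2 : ∏ x ∈ Z, (z - x) ^ Function.update w q m x = ∏ x ∈ Z, (z - x) ^ w x := by
        refine Finset.prod_congr rfl fun x hx => ?_
        rw [Function.update_of_ne]
        rintro rfl; exact hqZ hx
      rw [Finset.prod_insert hqZ, h2, Function.update_self, exp_add]
      have h3 := zpow_ne_zero m (sub_ne_zero.2 hz'.1)
      have h4 := exp_ne_zero (l (ρ z))
      rw [exp_neg, zpow_neg] at h1
      field_simp at h1
      rw [h1]; ring

/-- `HasLogIndex G p w` means that `G` has winding number `w` on small circles about `p`: on a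
punctured disc about `p`, it is `(z - p) ^ w` times the exponential of a continuous function. -/
def HasLogIndex (G : ℂ → ℂ) (p : ℂ) (w : ℤ) : Prop :=
  ∃ r > 0, ∃ L : ℂ → ℂ, ContinuousOn L (ball p r \ {p}) ∧
    ∀ z ∈ ball p r \ {p}, G z = (z - p) ^ w * exp (L z)

theorem HasLogIndex.of_continuousOn {G : ℂ → ℂ} {p : ℂ} {r : ℝ} (hr : 0 < r)
    (hG : ContinuousOn G (ball p r \ {p})) (h0 : ∀ z ∈ ball p r \ {p}, G z ≠ 0) :
    ∃ w, HasLogIndex G p w := by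
  obtain ⟨w, L, h1, h2⟩ := exists_zpow_mul_exp_on_punctured_ball hr hG h0
  exact ⟨w, r, hr, L, h1, h2⟩

theorem HasLogIndex.unique {G : ℂ → ℂ} {p : ℂ} {w w' : ℤ} (h : HasLogIndex G p w)
    (h' : HasLogIndex G p w') : w = w' := by
  obtain ⟨r, hr, L, hL, he⟩ := h
  obtain ⟨r', hr', L', hL', he'⟩ := h'
  have hs : 0 < min r r' / 2 := by positivity
  have hsub : sphere p (min r r' / 2) ⊆ (ball p r \ {p}) ∩ (ball p r' \ {p}) := by
    intro z hz
    have hz1 : dist z p = min r r' / 2 := hz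
    have hzp : z ≠ p := by rintro rfl; simp at hz1; linarith
    have := min_le_left r r'
    have := min_le_right r r'
    exact ⟨⟨by rw [mem_ball]; linarith, hzp⟩, ⟨by rw [mem_ball]; linarith, hzp⟩⟩
  refine sub_eq_zero.1 (eq_zero_of_zpow_eq_exp_on_sphere (p := p) hs (L := fun z => L' z - L z)
    ((hL'.mono (hsub.trans inter_subset_right)).sub (hL.mono (hsub.trans inter_subset_left)))
    fun z hz => ?_)
  have h1 := he z (hsub hz).1
  have h2 := he' z (hsub hz).2
  have hne : z - p ≠ 0 := sub_ne_zero.2 (hsub hz).1.2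
  rw [h1] at h2
  rw [zpow_sub₀ hne, exp_sub, div_eq_div_iff (zpow_ne_zero _ hne) (exp_ne_zero _), h2]
  ring

/-- The index of `G ^ m * g`, where `g` is continuous and nonvanishing at `p`. -/
theorem HasLogIndex.pow_mul {G H g : ℂ → ℂ} {p : ℂ} {w : ℤ} (h : HasLogIndex G p w) (m : ℕ)
    (hg : ∀ᶠ z in 𝓝 p, ContinuousAt g z) (hg0 : g p ≠ 0)
    (hH : ∀ᶠ z in 𝓝[≠] p, H z = G z ^ m * g z) : HasLogIndex H p (m * w) := by
  obtain ⟨r, hr, L, hL, he⟩ := h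
  have hslit : ∀ᶠ z in 𝓝 p, g z / g p ∈ slitPlane := by
    have : ContinuousAt (fun z => g z / g p) p := hg.self_of_nhds.div_const _
    exact this.eventually (isOpen_slitPlane.mem_nhds (by
      simp [div_self hg0]))
  obtain ⟨ε, hε, hεs⟩ := Metric.eventually_nhds_iff_ball.1
    (hg.and (hslit.and (eventually_nhdsWithin_iff.1 hH)))
  refine ⟨min r ε, by positivity, fun z => m * L z + (log (g z / g p) + log (g p)), ?_, ?_⟩
  · have h1 : ContinuousOn L (ball p (min r ε) \ {p}) :=
      hL.mono (sdiff_subset_sdiff_left (ball_subset_ball (min_le_left _ _)))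
    refine (continuousOn_const.mul h1).add ?_
    intro z hz
    obtain ⟨h2, h3, -⟩ := hεs z (ball_subset_ball (min_le_right _ _) hz.1)
    exact (((h2.div_const _).clog h3).add continuousAt_const).continuousWithinAt
  · rintro z ⟨hz, hzp⟩
    obtain ⟨-, h3, h4⟩ := hεs z (ball_subset_ball (min_le_right _ _) hz)
    have hne := slitPlane_ne_zero h3
    rw [h4 hzp, he z ⟨ball_subset_ball (min_le_left _ _) hz, hzp⟩, exp_add, exp_add,
      exp_log hne, exp_log hg0, div_mul_cancel₀ _ hg0, exp_nat_mul, mul_pow, mul_comm (m : ℤ),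
      zpow_mul, zpow_natCast, mul_assoc]

theorem zpow_sum_of_ne_zero {ι : Type*} {x : ℂ} (hx : x ≠ 0) (Z : Finset ι) (w : ι → ℤ) :
    x ^ (∑ q ∈ Z, w q) = ∏ q ∈ Z, x ^ w q := by
  classical
  induction Z using Finset.induction_on with
  | empty => simp
  | insert q Z hq ih => rw [Finset.sum_insert hq, Finset.prod_insert hq, zpow_add₀ hx, ih]

/-- A local homeomorphism of the plane has nonzero index at each point. -/
theorem OpenPartialHomeomorph.hasLogIndex_ne_zero (e : OpenPartialHomeomorph ℂ ℂ) {p : ℂ}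
    (hp : p ∈ e.source) {w : ℤ} (h : HasLogIndex (fun z => e z - e p) p w) : w ≠ 0 := by
  rintro rfl
  obtain ⟨r, hr, L, hL, he⟩ := h
  obtain ⟨δ, hδ, hδs⟩ := Metric.isOpen_iff.1 e.open_target (e p) (e.map_source hp)
  obtain ⟨w', L', hL', he'⟩ := exists_zpow_mul_exp_on_punctured_ball (p := e p) hδ
    (G := fun y => e.symm y - p)
    ((e.continuousOn_symm.mono (sdiff_subset.trans hδs)).sub continuousOn_const)
    (by
      rintro y ⟨hy, hyp⟩ h0
      exact hyp (by rw [mem_singleton_iff, ← sub_eq_zero.1 h0, e.right_inv (hδs hy)]))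
  have hev : ∀ᶠ z in 𝓝 p, z ∈ e.source ∧ e z ∈ ball (e p) δ ∧ z ∈ ball p r :=
    Filter.Eventually.and (e.open_source.mem_nhds hp)
      (((e.continuousAt hp).eventually (ball_mem_nhds _ hδ)).and (ball_mem_nhds _ hr))
  obtain ⟨ε, hε, hεs⟩ := Metric.eventually_nhds_iff_ball.1 hev
  have hsub : ∀ z ∈ sphere p (ε / 2), z ∈ e.source ∧ e z ∈ ball (e p) δ \ {e p} ∧
      z ∈ ball p r \ {p} := by
    intro z hz
    have hz1 : dist z p = ε / 2 := hz
    have hzp : z ≠ p := by rintro rfl; simp at hz1; linarith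
    obtain ⟨h1, h2, h3⟩ := hεs z (by rw [mem_ball]; linarith)
    exact ⟨h1, ⟨h2, fun h => hzp (e.injOn h1 hp h)⟩, h3, hzp⟩
  have := eq_zero_of_zpow_eq_exp_on_sphere (p := p) (half_pos hε) (m := 1)
    (L := fun z => w' * L z + L' (e z))
    ((continuousOn_const.mul (hL.mono fun z hz => (hsub z hz).2.2)).add
      (hL'.comp (e.continuousOn.mono fun z hz => (hsub z hz).1) fun z hz => (hsub z hz).2.1))
    (by
      intro z hz
      obtain ⟨h1, h2, h3⟩ := hsub z hz
      have h4 : e z - e p = _ := he z h3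
      have h5 := he' _ h2
      rw [e.left_inv h1, h4, zpow_zero, one_mul, ← exp_int_mul, ← exp_add] at h5
      rw [zpow_one, h5])
  exact one_ne_zero this

/-- Argument principle: if `K` has index `d` at its only zero `p` and `|a| < |K|` on a circle about
`p`, then the indices of `K - a` at the points inside the circle where `K = a` add up to `d`. -/
theorem exists_sum_hasLogIndex_eq {K L₀ : ℂ → ℂ} {p a : ℂ} {s r : ℝ} {d : ℤ} (hs : 0 < s)
    (hsr : s < r) (hK : ContinuousOn K (ball p r)) (hKp : K p = 0)
    (hL₀ : ContinuousOn L₀ (ball p r \ {p}))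
    (hKL : ∀ z ∈ ball p r \ {p}, K z = (z - p) ^ d * exp (L₀ z))
    (ha : ∀ z ∈ sphere p s, ‖a‖ < ‖K z‖) (Z : Finset ℂ)
    (hZ : ∀ q, q ∈ Z ↔ q ∈ ball p s ∧ K q = a) :
    ∃ w : ℂ → ℤ, (∀ q ∈ Z, HasLogIndex (fun z => K z - a) q (w q)) ∧ ∑ q ∈ Z, w q = d := by
  have hcb : closedBall p s ⊆ ball p r := closedBall_subset_ball hsr
  have hbb : ball p s ⊆ ball p r := ball_subset_closedBall.trans hcb
  obtain ⟨w, L, hL, hLe⟩ := exists_prod_zpow_mul_exp hs Z (c := p) (G := fun z => K z - a)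
    (fun q hq => ((hZ q).1 hq).1)
    ((hK.mono (sdiff_subset.trans hbb)).sub continuousOn_const)
    (by
      rintro z ⟨hz, hzZ⟩ h0
      exact hzZ ((hZ z).2 ⟨hz, sub_eq_zero.1 h0⟩))
  refine ⟨w, fun q hq => ?_, ?_⟩
  · -- Near `q`, all the other factors are continuous and nonvanishing.
    have hqb := ((hZ q).1 hq).1
    have hopen : IsOpen (ball p s \ (Z.erase q : Set ℂ)) :=
      isOpen_ball.sdiff (Finset.finite_toSet _).isClosed
    obtain ⟨δ, hδ, hδs⟩ := Metric.isOpen_iff.1 hopen q ⟨hqb, by simp⟩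
    have hsub : ball q δ \ {q} ⊆ ball p s \ Z := by
      rintro z ⟨hz, hzq⟩
      refine ⟨(hδs hz).1, fun hzZ => (hδs hz).2 ?_⟩
      exact Finset.mem_coe.2 (Finset.mem_erase.2 ⟨hzq, hzZ⟩)
    have h1 : HasLogIndex (fun z => (z - q) ^ w q * exp (L z)) q (w q) :=
      ⟨δ, hδ, L, hL.mono hsub, fun z _ => rfl⟩
    have h2 := h1.pow_mul (m := 1) (g := fun z => ∏ x ∈ Z.erase q, (z - x) ^ w x)
      (H := fun z => K z - a) ?_ ?_ ?_
    · simpa using h2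
    · filter_upwards [ball_mem_nhds q hδ] with z hz
      refine tendsto_finsetProd _ fun x hx => ?_
      refine ContinuousAt.zpow₀ (by fun_prop) _ (Or.inl (sub_ne_zero.2 ?_))
      rintro rfl
      exact (hδs hz).2 hx
    · refine Finset.prod_ne_zero_iff.2 fun x hx => zpow_ne_zero _ (sub_ne_zero.2 ?_)
      rintro rfl
      simp at hx
    · have : ball q δ \ {q} ∈ 𝓝[≠] q := sdiff_mem_nhdsWithin_compl (ball_mem_nhds q hδ) _
      filter_upwards [this] with z hz
      rw [hLe z (hsub hz), ← Finset.mul_prod_erase Z _ hq, pow_one]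
      ring
  · -- A circle inside `sphere p s` outside which `|K| > |a|`.
    have hC : IsCompact {z ∈ closedBall p s | ‖K z‖ ≤ ‖a‖} := by
      have : IsClosed {z ∈ closedBall p s | ‖K z‖ ≤ ‖a‖} :=
        (hK.mono hcb).norm.preimage_isClosed_of_isClosed isClosed_closedBall isClosed_Iic
      exact (isCompact_closedBall p s).of_isClosed_subset this (sep_subset _ _)
    obtain ⟨x, hx, hxm⟩ := hC.exists_isMaxOn (f := fun z => dist z p)
      ⟨p, by simp [hs.le, hKp]⟩ (by fun_prop)
    have hxs : dist x p < s := by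
      refine lt_of_le_of_ne hx.1 fun h => ?_
      exact absurd hx.2 (not_le.2 (ha x h))
    have ht0 : 0 < (dist x p + s) / 2 := by positivity
    have hts : (dist x p + s) / 2 < s := by linarith
    set t := (dist x p + s) / 2 with ht
    have hxt : dist x p < t := by linarith
    have hsph : ∀ z ∈ sphere p t, z ∈ ball p s ∧ z ≠ p ∧ ‖a‖ < ‖K z‖ := by
      intro z hz
      have hz1 : dist z p = t := hz
      have hzs : z ∈ ball p s := by rw [mem_ball]; linarith
      refine ⟨hzs, ?_, ?_⟩
      · rintro rfl; simp at hz1; linarith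
      · by_contra! h
        have := hxm ⟨ball_subset_closedBall hzs, h⟩
        simp only [mem_ofPred_eq] at this
        linarith
    have hZt : ∀ q ∈ Z, dist q p ≤ dist x p := by
      intro q hq
      obtain ⟨h1, h2⟩ := (hZ q).1 hq
      exact hxm ⟨ball_subset_closedBall h1, by rw [h2]⟩
    have hslit : ∀ b : ℂ, ‖b‖ < 1 → 1 - b ∈ slitPlane := by
      intro b hb
      simpa [sub_eq_add_neg] using mem_slitPlane_of_norm_lt_one (z := -b) (by simpa using hb)
    have hq1 : ∀ z ∈ sphere p t, ∀ q ∈ Z, ‖(q - p) / (z - p)‖ < 1 := by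
      intro z hz q hq
      have hz1 : dist z p = t := hz
      rw [norm_div, ← dist_eq, ← dist_eq, hz1, div_lt_one ht0]
      exact (hZt q hq).trans_lt hxt
    have ha1 : ∀ z ∈ sphere p t, ‖a / K z‖ < 1 := by
      intro z hz
      rw [norm_div, div_lt_one ((norm_nonneg a).trans_lt (hsph z hz).2.2)]
      exact (hsph z hz).2.2
    have hmemZ : ∀ z ∈ sphere p t, z ∉ (Z : Set ℂ) := by
      intro z hz hzZ
      have := ((hZ z).1 hzZ).2
      have := (hsph z hz).2.2
      simp_all
    refine sub_eq_zero.1 (eq_zero_of_zpow_eq_exp_on_sphere (p := p) ht0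
      (L := fun z => L₀ z + log (1 - a / K z) -
        (L z + ∑ q ∈ Z, w q * log (1 - (q - p) / (z - p)))) ?_ ?_)
    · refine ContinuousOn.sub (ContinuousOn.add ?_ ?_) (ContinuousOn.add ?_ ?_)
      · exact hL₀.mono fun z hz => ⟨hbb (hsph z hz).1, (hsph z hz).2.1⟩
      · refine ContinuousOn.clog (continuousOn_const.sub (continuousOn_const.div
          (hK.mono fun z hz => hbb (hsph z hz).1) fun z hz h0 => ?_)) fun z hz => hslit _ (ha1 z hz)
        have := (hsph z hz).2.2
        rw [h0, norm_zero] at this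
        exact absurd this (not_lt.2 (norm_nonneg a))
      · exact hL.mono fun z hz => ⟨(hsph z hz).1, hmemZ z hz⟩
      · refine continuousOn_finsetSum _ fun q hq => continuousOn_const.mul
          (ContinuousOn.clog (continuousOn_const.sub (continuousOn_const.div (by fun_prop)
            fun z hz => sub_ne_zero.2 (hsph z hz).2.1)) fun z hz => hslit _ (hq1 z hz q hq))
    · intro z hz
      have hzp : z - p ≠ 0 := sub_ne_zero.2 (hsph z hz).2.1
      have hK0 : K z ≠ 0 := by
        have := (hsph z hz).2.2
        exact norm_pos_iff.1 ((norm_nonneg a).trans_lt this)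
      have h1 : K z - a = _ := hLe z ⟨(hsph z hz).1, hmemZ z hz⟩
      have h2 := hKL z ⟨hbb (hsph z hz).1, (hsph z hz).2.1⟩
      have h3 : K z - a = (z - p) ^ d * exp (L₀ z + log (1 - a / K z)) := by
        rw [exp_add, exp_log (slitPlane_ne_zero (hslit _ (ha1 z hz))), ← mul_assoc, ← h2]
        field_simp
      have h4 : ∏ q ∈ Z, (z - q) ^ w q = (z - p) ^ (∑ q ∈ Z, w q) *
          exp (∑ q ∈ Z, w q * log (1 - (q - p) / (z - p))) := by
        rw [exp_sum, zpow_sum_of_ne_zero hzp, ← Finset.prod_mul_distrib]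
        refine Finset.prod_congr rfl fun q hq => ?_
        rw [exp_int_mul, exp_log (slitPlane_ne_zero (hslit _ (hq1 z hz q hq))), ← mul_zpow]
        congr 1
        field_simp
        ring
      rw [h4] at h1
      rw [h3] at h1
      rw [zpow_sub₀ hzp, exp_sub, exp_add (L z), div_eq_div_iff (zpow_ne_zero _ hzp)
        (mul_ne_zero (exp_ne_zero _) (exp_ne_zero _))]
      linear_combination -h1

/-! ### Holomorphic atlases on a punctured disc -/

/-- A holomorphic atlas on an open set `D` of the plane inducing the usual topology: for each point
`z` of `D` a chart `κ z` about `z`, with holomorphic changes of charts. -/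
structure IsHolomorphicAtlas (D : Set ℂ) (κ : ℂ → OpenPartialHomeomorph ℂ ℂ) : Prop where
  mem_source : ∀ z ∈ D, z ∈ (κ z).source
  analyticAt : ∀ z ∈ D, ∀ z' ∈ D, ∀ x ∈ D, x ∈ (κ z).source → x ∈ (κ z').source →
    AnalyticAt ℂ (κ z' ∘ (κ z).symm) (κ z x)

theorem OpenPartialHomeomorph.eventually_comp_symm_iff {e : OpenPartialHomeomorph ℂ ℂ} {p : ℂ}
    (hp : p ∈ e.source) {P : ℂ → Prop} :
    (∀ᶠ y in 𝓝 (e p), P (e.symm y)) ↔ ∀ᶠ z in 𝓝 p, P z := by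
  have h := e.symm.map_nhds_eq (e.map_source hp)
  rw [e.left_inv hp] at h
  rw [← h, eventually_map]

/-- The index of `k - k p` at `p`, for a function `k` that is holomorphic in the chart `e`, is the
index of the chart times the multiplicity `m ≥ 1` of the value `k p`. -/
theorem OpenPartialHomeomorph.hasLogIndex_of_analyticAt (e : OpenPartialHomeomorph ℂ ℂ) {p : ℂ}
    (hp : p ∈ e.source) {o : ℤ} (ho : HasLogIndex (fun z => e z - e p) p o) {k : ℂ → ℂ}
    (hk : AnalyticAt ℂ (k ∘ e.symm) (e p)) (hne : ¬ ∀ᶠ z in 𝓝 p, k z = k p) :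
    ∃ m : ℕ, 1 ≤ m ∧ HasLogIndex (fun z => k z - k p) p (m * o) ∧
      (m = 1 → deriv (k ∘ e.symm) (e p) ≠ 0) := by
  have hf : AnalyticAt ℂ (fun y => k (e.symm y) - k p) (e p) := hk.sub analyticAt_const
  have hnz : ¬ ∀ᶠ y in 𝓝 (e p), k (e.symm y) - k p = 0 := by
    rw [OpenPartialHomeomorph.eventually_comp_symm_iff hp (P := fun z => k z - k p = 0)]
    simpa only [sub_eq_zero] using hne
  obtain ⟨m, g, hg, hg0, heq⟩ := hf.exists_eventuallyEq_pow_smul_nonzero_iff.2 hnz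
  have hm : m ≠ 0 := by
    rintro rfl
    have := heq.self_of_nhds
    simp [e.left_inv hp] at this
    exact hg0 this.symm
  refine ⟨m, Nat.one_le_iff_ne_zero.2 hm, ?_, ?_⟩
  · refine ho.pow_mul m (g := fun z => g (e z)) ?_ hg0 ?_
    · have h1 := (e.continuousAt hp).eventually hg.eventually_analyticAt
      filter_upwards [h1, e.open_source.mem_nhds hp] with z hz hzs
      exact ContinuousAt.comp (g := g) hz.continuousAt (e.continuousAt hzs)
    · refine Filter.Eventually.filter_mono nhdsWithin_le_nhds ?_
      have h1 := (e.continuousAt hp).eventually heq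
      filter_upwards [h1, e.open_source.mem_nhds hp] with z hz hzs
      rw [e.left_inv hzs] at hz
      simpa using hz
  · rintro rfl
    have h1 : HasDerivAt (fun y => (y - e p) * g y) (1 * g (e p) + (e p - e p) * deriv g (e p))
        (e p) := ((hasDerivAt_id' _).sub_const _).mul hg.differentiableAt.hasDerivAt
    have h2 : HasDerivAt (fun y => k (e.symm y) - k p) (g (e p)) (e p) := by
      have h3 := h1.congr_of_eventuallyEq (f₁ := fun y => k (e.symm y) - k p) (by
        filter_upwards [heq] with y hy
        simpa using hy)
      simpa using h3
    have h3 : HasDerivAt (k ∘ e.symm) (g (e p)) (e p) := by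
      simpa [Function.comp_def] using h2.add_const (k p)
    rw [h3.deriv]
    exact hg0

theorem isPreconnected_ball_diff_singleton (p : ℂ) {r : ℝ} (hr : 0 < r) :
    IsPreconnected (ball p r \ {p}) := by
  have hU : Convex ℝ {w : ℂ | w.re < Real.log r} := convex_halfSpace_re_lt _
  have himg : (fun w => p + exp w) '' {w : ℂ | w.re < Real.log r} = ball p r \ {p} := by
    ext z
    constructor
    · rintro ⟨w, hw, rfl⟩
      refine ⟨?_, by simp⟩
      rw [mem_ball, dist_eq, add_sub_cancel_left, norm_exp]
      exact (Real.lt_log_iff_exp_lt hr).1 hw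
    · rintro ⟨hz, hzp⟩
      have hne : z - p ≠ 0 := sub_ne_zero.2 hzp
      refine ⟨log (z - p), ?_, by simp [exp_log hne]⟩
      change (log (z - p)).re < _
      rw [log_re]
      exact Real.log_lt_log (norm_pos_iff.2 hne) (by rwa [mem_ball, dist_eq] at hz)
  rw [← himg]
  exact hU.isPreconnected.image _ (by fun_prop)

theorem OpenPartialHomeomorph.exists_hasLogIndex (e : OpenPartialHomeomorph ℂ ℂ) {p : ℂ}
    (hp : p ∈ e.source) : ∃ o, HasLogIndex (fun z => e z - e p) p o := by
  obtain ⟨r, hr, hrs⟩ := Metric.isOpen_iff.1 e.open_source p hp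
  refine HasLogIndex.of_continuousOn hr
    ((e.continuousOn.mono (sdiff_subset.trans hrs)).sub continuousOn_const) ?_
  rintro z ⟨hz, hzp⟩ h
  exact hzp (e.injOn (hrs hz) hp (sub_eq_zero.1 h))

/-- The index of a local homeomorphism of the plane is locally constant. -/
theorem OpenPartialHomeomorph.eventually_hasLogIndex (e : OpenPartialHomeomorph ℂ ℂ) {p : ℂ}
    (hp : p ∈ e.source) {o : ℤ} (ho : HasLogIndex (fun z => e z - e p) p o) :
    ∀ᶠ q in 𝓝 p, HasLogIndex (fun z => e z - e q) q o := by
  obtain ⟨r, hr, hrs⟩ := Metric.isOpen_iff.1 e.open_source p hp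
  have hc : ContinuousOn (fun z => e z - e p) (ball p r) :=
    (e.continuousOn.mono hrs).sub continuousOn_const
  have hinj : ∀ z ∈ ball p r, ∀ q ∈ ball p r, e z = e q → z = q :=
    fun z hz q hq h => e.injOn (hrs hz) (hrs hq) h
  obtain ⟨d, L, hL, hd⟩ := exists_zpow_mul_exp_on_punctured_ball hr (hc.mono sdiff_subset) (by
    rintro z ⟨hz, hzp⟩ h
    exact hzp (hinj z hz p (mem_ball_self hr) (sub_eq_zero.1 h)))
  have hdo : d = o := HasLogIndex.unique ⟨r, hr, L, hL, hd⟩ ho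
  have hsub : sphere p (r / 2) ⊆ ball p r := sphere_subset_ball (by linarith)
  obtain ⟨x, hx, hxm⟩ := (isCompact_sphere p (r / 2)).exists_isMinOn
    (NormedSpace.sphere_nonempty.2 (by linarith)) (hc.mono hsub).norm
  have hxp : 0 < ‖e x - e p‖ := by
    refine norm_pos_iff.2 (sub_ne_zero.2 fun h => ?_)
    have := hinj x (hsub hx) p (mem_ball_self hr) h
    rw [this] at hx
    simp at hx
    linarith
  have hev : ∀ᶠ q in 𝓝 p, ‖e q - e p‖ < ‖e x - e p‖ := by
    have h1 : ContinuousAt (fun q => ‖e q - e p‖) p :=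
      ((e.continuousAt hp).sub continuousAt_const).norm
    exact h1.eventually_lt_const (by simpa using hxp)
  filter_upwards [hev, ball_mem_nhds p (half_pos hr)] with q hq hqb
  obtain ⟨w, hw, hsum⟩ := exists_sum_hasLogIndex_eq (a := e q - e p) (half_pos hr)
    (half_lt_self hr) hc (by simp) hL hd (fun z hz => hq.trans_le (hxm hz)) {q} (by
      intro z
      simp only [Finset.mem_singleton, sub_left_inj]
      constructor
      · rintro rfl; exact ⟨hqb, rfl⟩
      · rintro ⟨h1, h2⟩
        exact hinj z (ball_subset_ball (by linarith) h1) q (ball_subset_ball (by linarith) hqb) h2)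
  have h1 := hw q (by simp)
  simp only [Finset.sum_singleton] at hsum
  simpa [hsum, hdo] using h1

theorem OpenPartialHomeomorph.not_eventually_eq (e : OpenPartialHomeomorph ℂ ℂ) {p : ℂ}
    (hp : p ∈ e.source) : ¬ ∀ᶠ z in 𝓝 p, e z = e p := by
  intro h
  have : ∀ᶠ z in 𝓝[≠] p, False := by
    rw [eventually_nhdsWithin_iff]
    filter_upwards [h, e.open_source.mem_nhds hp] with z hz hzs hzp
    exact hzp (e.injOn hzs hp hz)
  exact this.exists.elim fun _ h => h

/-- All charts of a holomorphic atlas on a connected plane domain have the same index, because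
holomorphic changes of charts preserve the orientation. -/
theorem IsHolomorphicAtlas.exists_hasLogIndex {D : Set ℂ} {κ : ℂ → OpenPartialHomeomorph ℂ ℂ}
    (hκ : IsHolomorphicAtlas D κ) (hDo : IsOpen D) (hD : IsPreconnected D) :
    ∃ o : ℤ, ∀ z ∈ D, HasLogIndex (fun x => κ z x - κ z z) z o := by
  have hex : ∀ z, ∃ o, z ∈ D → HasLogIndex (fun x => κ z x - κ z z) z o := by
    intro z
    by_cases hz : z ∈ D
    · obtain ⟨o, ho⟩ := (κ z).exists_hasLogIndex (hκ.mem_source z hz)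
      exact ⟨o, fun _ => ho⟩
    · exact ⟨0, fun h => absurd h hz⟩
  choose o ho using hex
  have hloc : ContinuousOn o D := by
    intro z hz
    have hzs := hκ.mem_source z hz
    refine ContinuousAt.continuousWithinAt ?_
    rw [ContinuousAt, nhds_discrete ℤ, tendsto_pure]
    filter_upwards [(κ z).eventually_hasLogIndex hzs (ho z hz), hDo.mem_nhds hz,
      (κ z).open_source.mem_nhds hzs] with q hq hqD hqs
    have hqs' := hκ.mem_source q hqD
    obtain ⟨m, hm, hm', -⟩ := (κ z).hasLogIndex_of_analyticAt hqs hq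
      (hκ.analyticAt z hz q hqD q hqD hqs hqs') ((κ q).not_eventually_eq hqs')
    obtain ⟨n, hn, hn', -⟩ := (κ q).hasLogIndex_of_analyticAt hqs' (ho q hqD)
      (hκ.analyticAt q hqD z hz q hqD hqs' hqs) ((κ z).not_eventually_eq hqs)
    have h1 : o q = m * o z := (ho q hqD).unique hm'
    have h2 : o z = n * o q := hq.unique hn'
    have h3 : o z ≠ 0 := (κ z).hasLogIndex_ne_zero hzs (ho z hz)
    have h4 : ((n * m : ℕ) : ℤ) * o z = 1 * o z := by
      push_cast; rw [mul_assoc, ← h1, ← h2, one_mul]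
    have h5 : n * m = 1 := by exact_mod_cast mul_right_cancel₀ h3 h4
    rw [h1, Nat.eq_one_of_mul_eq_one_left h5]
    simp
  rcases D.eq_empty_or_nonempty with rfl | ⟨z₀, hz₀⟩
  · exact ⟨0, by simp⟩
  · exact ⟨o z₀, fun z hz => hD.constant hloc hz hz₀ ▸ ho z hz⟩

/-- `k` is holomorphic on `D` in the charts `κ`. -/
def HolomorphicInCharts (κ : ℂ → OpenPartialHomeomorph ℂ ℂ) (D : Set ℂ) (k : ℂ → ℂ) : Prop :=
  ∀ z ∈ D, AnalyticAt ℂ (k ∘ (κ z).symm) (κ z z)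

theorem HolomorphicInCharts.continuousAt {D : Set ℂ} {κ : ℂ → OpenPartialHomeomorph ℂ ℂ}
    (hκ : IsHolomorphicAtlas D κ) {k : ℂ → ℂ} (hk : HolomorphicInCharts κ D k) {z : ℂ}
    (hz : z ∈ D) : ContinuousAt k z := by
  have hzs := hκ.mem_source z hz
  have h1 : ContinuousAt ((k ∘ (κ z).symm) ∘ κ z) z :=
    ContinuousAt.comp (hk z hz).continuousAt ((κ z).continuousAt hzs)
  refine h1.congr ?_
  filter_upwards [(κ z).eventually_left_inverse hzs] with x hx
  simp [hx]

/-- Identity theorem. -/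
theorem HolomorphicInCharts.eq_or_eventually_ne {D : Set ℂ} {κ : ℂ → OpenPartialHomeomorph ℂ ℂ}
    (hκ : IsHolomorphicAtlas D κ) (hD : IsPreconnected D) {k : ℂ → ℂ}
    (hk : HolomorphicInCharts κ D k) (a : ℂ) :
    (∀ z ∈ D, k z = a) ∨ ∀ z ∈ D, ∀ᶠ x in 𝓝[≠] z, k x ≠ a := by
  have hu : IsOpen {z | ∀ᶠ x in 𝓝 z, k x = a} := isOpen_setOfPred_eventually_nhds
  have hv : IsOpen {z | ∀ᶠ x in 𝓝[≠] z, k x ≠ a} := isOpen_setOfPred_eventually_nhdsWithin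
  have hdisj : Disjoint {z | ∀ᶠ x in 𝓝 z, k x = a} {z | ∀ᶠ x in 𝓝[≠] z, k x ≠ a} := by
    rw [Set.disjoint_left]
    intro z h1 h2
    have : ∀ᶠ x in 𝓝[≠] z, False := by
      filter_upwards [h2, nhdsWithin_le_nhds (s := {z}ᶜ) h1] with x hx hx'
      exact hx hx'
    exact this.exists.elim fun _ h => h
  have hcov : D ⊆ {z | ∀ᶠ x in 𝓝 z, k x = a} ∪ {z | ∀ᶠ x in 𝓝[≠] z, k x ≠ a} := by
    intro z hz
    have hzs := hκ.mem_source z hz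
    have hf : AnalyticAt ℂ (fun y => k ((κ z).symm y) - a) (κ z z) := (hk z hz).sub analyticAt_const
    rcases hf.eventually_eq_zero_or_eventually_ne_zero with h | h
    · left
      rw [OpenPartialHomeomorph.eventually_comp_symm_iff hzs (P := fun z => k z - a = 0)] at h
      change ∀ᶠ x in 𝓝 z, k x = a
      simpa only [sub_eq_zero] using h
    · right
      rw [eventually_nhdsWithin_iff] at h
      change ∀ᶠ x in 𝓝[≠] z, k x ≠ a
      rw [eventually_nhdsWithin_iff]
      filter_upwards [((κ z).continuousAt hzs).eventually h, (κ z).open_source.mem_nhds hzs]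
        with x hx hxs hxz
      rw [(κ z).left_inv hxs] at hx
      exact sub_ne_zero.1 (hx fun h => hxz ((κ z).injOn hxs hzs h))
  rcases hD.subset_or_subset hu hv hdisj hcov with h | h
  · exact .inl fun z hz => (h hz).self_of_nhds
  · exact .inr fun z hz => h hz

/-- A continuous `n`-th root of a nonvanishing holomorphic function is holomorphic. -/
theorem AnalyticAt.of_pow {G : ℂ → ℂ} {y : ℂ} {n : ℕ} (hn : n ≠ 0) (hc : ContinuousAt G y)
    (h0 : G y ≠ 0) (h : AnalyticAt ℂ (fun x => G x ^ n) y) : AnalyticAt ℂ G y := by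
  have hP : AnalyticAt ℂ (fun x : ℂ => x ^ n) (G y) := analyticAt_id.pow n
  have hP' : deriv (fun x : ℂ => x ^ n) (G y) ≠ 0 := by
    simp [hn, h0]
  have h1 := hP.analyticAt_localInverse hP'
  have h2 := AnalyticAt.fun_comp (f := fun x => G x ^ n) h1 h
  refine h2.congr ?_
  have h3 := hc.eventually (HasStrictFDerivAt.eventually_left_inverse
    (hf := hP.hasStrictDerivAt.hasStrictFDerivAt_equiv hP'))
  filter_upwards [h3] with x hx
  exact hx

theorem HolomorphicInCharts.continuousOn {κ : ℂ → OpenPartialHomeomorph ℂ ℂ} {ρ : ℝ}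
    (hκ : IsHolomorphicAtlas (ball 0 ρ \ {0}) κ) {k : ℂ → ℂ}
    (hk : HolomorphicInCharts κ (ball 0 ρ \ {0}) k) (hk0 : ContinuousAt k 0) :
    ContinuousOn k (ball 0 ρ) := by
  intro z hz
  refine ContinuousAt.continuousWithinAt ?_
  by_cases hz0 : z = 0
  · rwa [hz0]
  · exact hk.continuousAt hκ ⟨hz, hz0⟩

/-- Solutions of `k = a` near a puncture, where `k` vanishes at the puncture only: the sum of their
multiplicities times the index `o` of the charts is the index `d` of `k` at the puncture. -/
theorem HolomorphicInCharts.exists_sum_mul_eq {κ : ℂ → OpenPartialHomeomorph ℂ ℂ} {ρ s : ℝ}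
    (hs : 0 < s) (hsρ : s < ρ) (hκ : IsHolomorphicAtlas (ball 0 ρ \ {0}) κ) {o : ℤ}
    (ho : ∀ z ∈ ball 0 ρ \ {0}, HasLogIndex (fun x => κ z x - κ z z) z o) {k : ℂ → ℂ}
    (hk : HolomorphicInCharts κ (ball 0 ρ \ {0}) k) (hk0 : ContinuousAt k 0) (hk0' : k 0 = 0)
    {d : ℤ} (hd : HasLogIndex k 0 d) (hne : ∀ z ∈ ball 0 ρ \ {0}, k z ≠ 0)
    {a : ℂ} (ha0 : a ≠ 0) (ha : ∀ z ∈ sphere 0 s, ‖a‖ < ‖k z‖) :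
    ∃ (Z : Finset ℂ) (m : ℂ → ℕ), (∀ q, q ∈ Z ↔ q ∈ ball 0 s ∧ k q = a) ∧
      (∀ q ∈ Z, 1 ≤ m q ∧ (m q = 1 → deriv (k ∘ (κ q).symm) (κ q q) ≠ 0)) ∧
      ((∑ q ∈ Z, m q : ℕ) : ℤ) * o = d := by
  have hρ : 0 < ρ := hs.trans hsρ
  have hc := hk.continuousOn hκ hk0
  have hpre : IsPreconnected (ball (0 : ℂ) ρ \ {0}) := isPreconnected_ball_diff_singleton 0 hρ
  have hnear0 : ∀ᶠ z in 𝓝 0, k z ≠ a := hk0.eventually_ne (by rw [hk0']; exact ha0.symm)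
  have hev : ∀ z ∈ ball (0 : ℂ) ρ, ∀ᶠ x in 𝓝[≠] z, k x ≠ a := by
    intro z hz
    by_cases hz0 : z = 0
    · rw [hz0]; exact hnear0.filter_mono nhdsWithin_le_nhds
    · rcases hk.eq_or_eventually_ne hκ hpre a with h | h
      · exfalso
        have h1 : ∀ᶠ x in 𝓝[≠] (0 : ℂ), False := by
          filter_upwards [hnear0.filter_mono nhdsWithin_le_nhds,
            sdiff_mem_nhdsWithin_compl (ball_mem_nhds (0 : ℂ) hρ) {0}] with x hx hx'
          exact hx (h x hx')
        exact h1.exists.elim fun _ h => h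
      · exact h z ⟨hz, hz0⟩
  have hfin : {q | q ∈ ball 0 s ∧ k q = a}.Finite := by
    by_contra hinf
    obtain ⟨x, hx, hacc⟩ := Set.Infinite.exists_accPt_of_subset_isCompact hinf
      (isCompact_closedBall (0 : ℂ) s) fun q hq => ball_subset_closedBall hq.1
    rw [accPt_iff_frequently_nhdsNE] at hacc
    obtain ⟨y, hy, hy'⟩ := (hacc.and_eventually (hev x (closedBall_subset_ball hsρ hx))).exists
    exact hy' hy.2
  have hZ : ∀ q, q ∈ hfin.toFinset ↔ q ∈ ball 0 s ∧ k q = a := fun q => by simp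
  obtain ⟨d', L, hL, hLe⟩ := exists_zpow_mul_exp_on_punctured_ball hρ (hc.mono sdiff_subset) hne
  have hdd : d' = d := HasLogIndex.unique ⟨ρ, hρ, L, hL, hLe⟩ hd
  obtain ⟨w, hw, hsum⟩ := exists_sum_hasLogIndex_eq hs hsρ hc hk0' hL hLe ha hfin.toFinset hZ
  have hm : ∀ q, ∃ m : ℕ, q ∈ hfin.toFinset →
      w q = m * o ∧ 1 ≤ m ∧ (m = 1 → deriv (k ∘ (κ q).symm) (κ q q) ≠ 0) := by
    intro q
    by_cases hq : q ∈ hfin.toFinset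
    · obtain ⟨hqs, hqa⟩ := (hZ q).1 hq
      have hqD : q ∈ ball (0 : ℂ) ρ \ {0} := by
        refine ⟨ball_subset_ball hsρ.le hqs, fun h => ha0 ?_⟩
        rw [← hqa, mem_singleton_iff.1 h, hk0']
      have hnc : ¬ ∀ᶠ z in 𝓝 q, k z = k q := by
        intro h
        have h1 : ∀ᶠ x in 𝓝[≠] q, False := by
          filter_upwards [hev q hqD.1, h.filter_mono nhdsWithin_le_nhds] with x hx hx'
          exact hx (hx'.trans hqa)
        exact h1.exists.elim fun _ h => h
      obtain ⟨m, hm1, hm2, hm3⟩ := (κ q).hasLogIndex_of_analyticAt (hκ.mem_source q hqD)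
        (ho q hqD) (hk q hqD) hnc
      rw [hqa] at hm2
      exact ⟨m, fun _ => ⟨(hw q hq).unique hm2, hm1, hm3⟩⟩
    · exact ⟨0, fun h => absurd h hq⟩
  choose m hm using hm
  refine ⟨hfin.toFinset, m, hZ, fun q hq => (hm q hq).2, ?_⟩
  rw [← hdd, ← hsum, Nat.cast_sum, Finset.sum_mul]
  exact Finset.sum_congr rfl fun q hq => (hm q hq).1.symm

/-- A continuous function without zeros on a circle is bounded below there. -/
theorem exists_pos_le_norm_on_sphere {k : ℂ → ℂ} {s : ℝ} (hs : 0 < s)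
    (hc : ContinuousOn k (sphere 0 s)) (hne : ∀ z ∈ sphere 0 s, k z ≠ 0) :
    ∃ μ > 0, ∀ z ∈ sphere 0 s, μ ≤ ‖k z‖ := by
  obtain ⟨x, hx, hxm⟩ := (isCompact_sphere (0 : ℂ) s).exists_isMinOn
    (NormedSpace.sphere_nonempty.2 hs.le) hc.norm
  exact ⟨‖k x‖, norm_pos_iff.2 (hne x hx), fun z hz => hxm hz⟩

/-- A holomorphic function on a punctured disc that is nonvanishing and tends to zero at the
puncture has nonzero index there, with respect to any holomorphic atlas. -/
theorem HolomorphicInCharts.index_ne_zero {κ : ℂ → OpenPartialHomeomorph ℂ ℂ} {ρ : ℝ}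
    (hρ : 0 < ρ) (hκ : IsHolomorphicAtlas (ball 0 ρ \ {0}) κ) {k : ℂ → ℂ}
    (hk : HolomorphicInCharts κ (ball 0 ρ \ {0}) k) (hk0 : ContinuousAt k 0) (hk0' : k 0 = 0)
    {d : ℤ} (hd : HasLogIndex k 0 d) (hne : ∀ z ∈ ball 0 ρ \ {0}, k z ≠ 0) : d ≠ 0 := by
  rintro rfl
  have hDo : IsOpen (ball (0 : ℂ) ρ \ {0}) := isOpen_ball.sdiff isClosed_singleton
  obtain ⟨o, ho⟩ := hκ.exists_hasLogIndex hDo (isPreconnected_ball_diff_singleton 0 hρ)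
  have hsub : sphere (0 : ℂ) (ρ / 2) ⊆ ball 0 ρ \ {0} := by
    intro z hz
    have hz1 : dist z 0 = ρ / 2 := hz
    refine ⟨by rw [mem_ball]; linarith, ?_⟩
    rintro rfl
    simp at hz1
    linarith
  obtain ⟨μ, hμ, hμs⟩ := exists_pos_le_norm_on_sphere (half_pos hρ)
    ((hk.continuousOn hκ hk0).mono (hsub.trans sdiff_subset)) fun z hz => hne z (hsub hz)
  have hev : ∀ᶠ z in 𝓝[≠] (0 : ℂ), ‖k z‖ < μ ∧ z ∈ ball 0 (ρ / 2) \ {0} :=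
    Filter.Eventually.and
      ((hk0.norm.eventually_lt_const (by simpa [hk0'] using hμ)).filter_mono nhdsWithin_le_nhds)
      (sdiff_mem_nhdsWithin_compl (ball_mem_nhds (0 : ℂ) (half_pos hρ)) {0})
  obtain ⟨z, hzμ, hzb, hz0⟩ := hev.exists
  have hzD : z ∈ ball 0 ρ \ {0} := ⟨ball_subset_ball (by linarith) hzb, hz0⟩
  obtain ⟨Z, m, hZ, hm, hsum⟩ := hk.exists_sum_mul_eq (half_pos hρ) (half_lt_self hρ) hκ ho hk0
    hk0' hd hne (hne z hzD) fun x hx => hzμ.trans_le (hμs x hx)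
  have ho0 : o ≠ 0 := (κ z).hasLogIndex_ne_zero (hκ.mem_source z hzD) (ho z hzD)
  have h1 := (mul_eq_zero.1 hsum).resolve_right ho0
  have h2 : ∑ q ∈ Z, m q = 0 := by exact_mod_cast h1
  have hzZ := (hZ z).2 ⟨hzb, rfl⟩
  have := (Finset.sum_eq_zero_iff.1 h2) z hzZ
  have := (hm z hzZ).1
  omega

/-- If some holomorphic function without zeros tends to zero at the puncture, then there is one
whose index at the puncture is `1` or `-1`: a holomorphic root of order `|d|`, where `d ≠ 0` is the
index of the given function. -/
theorem HolomorphicInCharts.exists_abs_index_eq_one {κ : ℂ → OpenPartialHomeomorph ℂ ℂ} {ρ : ℝ}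
    (hρ : 0 < ρ) (hκ : IsHolomorphicAtlas (ball 0 ρ \ {0}) κ) {h : ℂ → ℂ}
    (hh : HolomorphicInCharts κ (ball 0 ρ \ {0}) h) (hh0 : ContinuousAt h 0) (hh0' : h 0 = 0)
    (hne : ∀ z ∈ ball 0 ρ \ {0}, h z ≠ 0) :
    ∃ (k : ℂ → ℂ) (σ : ℤ), |σ| = 1 ∧ HolomorphicInCharts κ (ball 0 ρ \ {0}) k ∧
      ContinuousAt k 0 ∧ k 0 = 0 ∧ HasLogIndex k 0 σ ∧ ∀ z ∈ ball 0 ρ \ {0}, k z ≠ 0 := by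
  have hDo : IsOpen (ball (0 : ℂ) ρ \ {0}) := isOpen_ball.sdiff isClosed_singleton
  obtain ⟨d, L, hL, hLe⟩ := exists_zpow_mul_exp_on_punctured_ball hρ
    ((hh.continuousOn hκ hh0).mono sdiff_subset) hne
  have hd0 : d ≠ 0 := hh.index_ne_zero hρ hκ hh0 hh0' ⟨ρ, hρ, L, hL, hLe⟩ hne
  set n := d.natAbs with hn
  have hn0 : n ≠ 0 := Int.natAbs_ne_zero.2 hd0
  set k : ℂ → ℂ := fun z => if z = 0 then 0 else z ^ d.sign * exp (L z / n) with hkdef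
  have hkD : ∀ z ∈ ball (0 : ℂ) ρ \ {0}, k z = z ^ d.sign * exp (L z / n) := by
    rintro z ⟨-, hz⟩
    rw [mem_singleton_iff] at hz
    simp [hkdef, hz]
  have hk0 : k 0 = 0 := by simp [hkdef]
  have hkne : ∀ z ∈ ball 0 ρ \ {0}, k z ≠ 0 := by
    intro z hz
    rw [hkD z hz]
    exact mul_ne_zero (zpow_ne_zero _ hz.2) (exp_ne_zero _)
  have hpow : ∀ z ∈ ball 0 ρ \ {0}, k z ^ n = h z := by
    intro z hz
    rw [hkD z hz, hLe z hz, mul_pow, ← exp_nat_mul, mul_div_cancel₀ _ (Nat.cast_ne_zero.2 hn0),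
      ← zpow_natCast, ← zpow_mul, hn, Int.sign_mul_natAbs, sub_zero]
  have hkc : ∀ z ∈ ball (0 : ℂ) ρ \ {0}, ContinuousAt k z := by
    intro z hz
    have h1 : ContinuousAt (fun z => z ^ d.sign * exp (L z / n)) z :=
      (ContinuousAt.zpow₀ continuousAt_id _ (Or.inl hz.2)).mul
        ((hL.continuousAt (hDo.mem_nhds hz)).div_const _).cexp
    refine h1.congr ?_
    filter_upwards [hDo.mem_nhds hz] with x hx
    rw [hkD x hx]
  refine ⟨k, d.sign, Int.abs_sign_of_ne_zero hd0, ?_, ?_, hk0,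
    ⟨ρ, hρ, fun z => L z / n, hL.div_const _, fun z hz => ?_⟩, hkne⟩
  · intro z hz
    have hzs := hκ.mem_source z hz
    refine AnalyticAt.of_pow hn0 ?_ ?_ ((hh z hz).congr ?_)
    · refine ContinuousAt.comp ?_ ((κ z).continuousAt_symm ((κ z).map_source hzs))
      rw [(κ z).left_inv hzs]
      exact hkc z hz
    · simp only [Function.comp_apply, (κ z).left_inv hzs]
      exact hkne z hz
    · have : ∀ᶠ x in 𝓝 z, h x = k x ^ n := by
        filter_upwards [hDo.mem_nhds hz] with x hx
        exact (hpow x hx).symm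
      exact (OpenPartialHomeomorph.eventually_comp_symm_iff hzs).2 this
  · have h1 : Tendsto (fun z => ‖h z‖) (𝓝 0) (𝓝 0) := by simpa [hh0'] using hh0.norm.tendsto
    rw [ContinuousAt, hk0, Metric.tendsto_nhds]
    intro ε hε
    have h2 := h1.eventually_lt_const (pow_pos hε n)
    filter_upwards [h2, ball_mem_nhds (0 : ℂ) hρ] with z hz hzb
    rw [dist_zero_right]
    by_cases hz0 : z = 0
    · rw [hz0, hk0, norm_zero]; exact hε
    · rw [← hpow z ⟨hzb, hz0⟩, norm_pow] at hz
      exact lt_of_pow_lt_pow_left₀ n hε.le hz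
  · rw [hkD z hz, sub_zero]

/-- If a punctured disc with some holomorphic atlas carries a nonvanishing holomorphic function
that tends to zero at the puncture, then the atlas extends over the puncture: there is a
homeomorphism from a neighbourhood of the puncture to an open set of the plane that is biholomorphic
off the puncture. -/
theorem HolomorphicInCharts.exists_chart_at_puncture {κ : ℂ → OpenPartialHomeomorph ℂ ℂ} {ρ : ℝ}
    (hρ : 0 < ρ) (hκ : IsHolomorphicAtlas (ball 0 ρ \ {0}) κ) {h : ℂ → ℂ}
    (hh : HolomorphicInCharts κ (ball 0 ρ \ {0}) h) (hh0 : ContinuousAt h 0) (hh0' : h 0 = 0)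
    (hne : ∀ z ∈ ball 0 ρ \ {0}, h z ≠ 0) :
    ∃ K : OpenPartialHomeomorph ℂ ℂ, 0 ∈ K.source ∧ K.source ⊆ ball 0 ρ ∧ K 0 = 0 ∧
      ∀ z ∈ K.source, z ≠ 0 → AnalyticAt ℂ (K ∘ (κ z).symm) (κ z z) ∧
        AnalyticAt ℂ (κ z ∘ K.symm) (K z) := by
  obtain ⟨k, σ, hσ, hk, hk0, hk0', hkσ, hkne⟩ := hh.exists_abs_index_eq_one hρ hκ hh0 hh0' hne
  have hDo : IsOpen (ball (0 : ℂ) ρ \ {0}) := isOpen_ball.sdiff isClosed_singleton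
  obtain ⟨o, ho⟩ := hκ.exists_hasLogIndex hDo (isPreconnected_ball_diff_singleton 0 hρ)
  have hc := hk.continuousOn hκ hk0
  -- Small nonzero values are taken exactly once, with multiplicity one.
  have hbij : ∀ s, 0 < s → s < ρ → ∃ μ > 0, ∀ a, a ≠ 0 → ‖a‖ < μ →
      ∃ q ∈ ball (0 : ℂ) s, k q = a ∧ deriv (k ∘ (κ q).symm) (κ q q) ≠ 0 ∧
        ∀ q' ∈ ball (0 : ℂ) s, k q' = a → q' = q := by
    intro s hs hsρ
    have hsub : sphere (0 : ℂ) s ⊆ ball 0 ρ \ {0} := by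
      intro z hz
      have hz1 : dist z 0 = s := hz
      refine ⟨by rw [mem_ball]; linarith, ?_⟩
      rintro rfl
      simp at hz1
      linarith
    obtain ⟨μ, hμ, hμs⟩ := exists_pos_le_norm_on_sphere hs (hc.mono (hsub.trans sdiff_subset))
      fun z hz => hkne z (hsub hz)
    refine ⟨μ, hμ, fun a ha0 ha => ?_⟩
    obtain ⟨Z, m, hZ, hm, hsum⟩ := hk.exists_sum_mul_eq hs hsρ hκ ho hk0 hk0' hkσ hkne ha0
      fun x hx => ha.trans_le (hμs x hx)
    have h1 : ∑ q ∈ Z, m q = 1 := by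
      have h2 : |((∑ q ∈ Z, m q : ℕ) : ℤ)| * |o| = 1 := by rw [← abs_mul, hsum, hσ]
      rw [Nat.abs_cast] at h2
      have h3 := Int.eq_one_or_neg_one_of_mul_eq_one h2
      omega
    have hcard : Z.card ≤ 1 := by
      rw [← h1, Finset.card_eq_sum_ones]
      exact Finset.sum_le_sum fun q hq => (hm q hq).1
    have hZne : Z.Nonempty := by
      rw [Finset.nonempty_iff_ne_empty]
      rintro rfl
      simp at h1
    obtain ⟨q, hq⟩ := hZne
    have hmq : m q = 1 := by
      refine le_antisymm ?_ (hm q hq).1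
      rw [← h1]
      exact Finset.single_le_sum (f := m) (fun _ _ => Nat.zero_le _) hq
    refine ⟨q, ((hZ q).1 hq).1, ((hZ q).1 hq).2, (hm q hq).2 hmq, fun q' hq' hqa => ?_⟩
    exact Finset.card_le_one.1 hcard q' ((hZ q').2 ⟨hq', hqa⟩) q hq
  obtain ⟨μ, hμ, hμb⟩ := hbij (ρ / 2) (half_pos hρ) (half_lt_self hρ)
  set U : Set ℂ := ball 0 (ρ / 2) ∩ k ⁻¹' ball 0 μ with hU
  have hbb : ball (0 : ℂ) (ρ / 2) ⊆ ball 0 ρ := ball_subset_ball (by linarith)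
  have hUo : IsOpen U := (hc.mono hbb).isOpen_inter_preimage isOpen_ball isOpen_ball
  have h0U : (0 : ℂ) ∈ U := ⟨mem_ball_self (half_pos hρ), by simp [hk0', hμ]⟩
  have hzero : ∀ q ∈ ball (0 : ℂ) (ρ / 2), k q = 0 → q = 0 := by
    intro q hq hq0
    by_contra h
    exact hkne q ⟨hbb hq, h⟩ hq0
  have hUbij : BijOn k U (ball 0 μ) := by
    refine ⟨fun z hz => hz.2, ?_, ?_⟩
    · intro x hx y hy hxy
      by_cases hx0 : k x = 0
      · rw [hzero x hx.1 hx0, hzero y hy.1 (hxy ▸ hx0)]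
      · obtain ⟨q, -, -, -, hq⟩ := hμb (k x) hx0 (by simpa using hx.2)
        rw [hq x hx.1 rfl, hq y hy.1 hxy.symm]
    · intro a ha
      by_cases ha0 : a = 0
      · exact ⟨0, h0U, by rw [hk0', ha0]⟩
      · obtain ⟨q, hq, hqa, -⟩ := hμb a ha0 (by simpa using ha)
        exact ⟨q, ⟨hq, by rw [mem_preimage, hqa]; exact ha⟩, hqa⟩
  have hder : ∀ z ∈ U, z ≠ 0 → deriv (k ∘ (κ z).symm) (κ z z) ≠ 0 := by
    intro z hz hz0
    obtain ⟨q, hq, -, hqd, hqu⟩ := hμb (k z) (hkne z ⟨hbb hz.1, hz0⟩) (by simpa using hz.2)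
    rw [hqu z hz.1 rfl]
    exact hqd
  have hopen : ∀ z ∈ U, 𝓝 (k z) ≤ map k (𝓝 z) := by
    intro z hz
    by_cases hz0 : z = 0
    · subst hz0
      rw [hk0']
      intro V hV
      obtain ⟨s, hs, hsV⟩ := Metric.mem_nhds_iff.1 (mem_map.1 hV)
      obtain ⟨ν, hν, hνb⟩ := hbij (min s (ρ / 2)) (by positivity)
        ((min_le_right _ _).trans_lt (half_lt_self hρ))
      refine Metric.mem_nhds_iff.2 ⟨ν, hν, fun a ha => ?_⟩
      by_cases ha0 : a = 0
      · have := hsV (mem_ball_self hs)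
        rwa [mem_preimage, hk0', ← ha0] at this
      · obtain ⟨q, hq, hqa, -⟩ := hνb a ha0 (by simpa using ha)
        rw [← hqa]
        exact hsV (ball_subset_ball (min_le_left _ _) hq)
    · have hzD : z ∈ ball 0 ρ \ {0} := ⟨hbb hz.1, hz0⟩
      have hzs := hκ.mem_source z hzD
      have h1 := (hk z hzD).hasStrictDerivAt.map_nhds_eq (hder z hz hz0)
      rw [← Filter.map_map] at h1
      have h2 := (κ z).symm.map_nhds_eq ((κ z).map_source hzs)
      rw [(κ z).left_inv hzs] at h2
      rw [h2] at h1
      simp only [Function.comp_apply, (κ z).left_inv hzs] at h1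
      exact h1.ge
  have hom : IsOpenMap ((hUbij.toPartialEquiv k U _).source.domRestrict
      (hUbij.toPartialEquiv k U _)) := by
    rw [isOpenMap_iff_nhds_le]
    rintro ⟨z, hz⟩
    have h1 : map (Subtype.val : U → ℂ) (𝓝 ⟨z, hz⟩) = 𝓝 z := map_nhds_subtype_coe_eq_nhds hz
      (hUo.mem_nhds hz)
    have h2 := hopen z hz
    rw [← h1, Filter.map_map] at h2
    exact h2
  let K : OpenPartialHomeomorph ℂ ℂ :=
    OpenPartialHomeomorph.ofContinuousOpenRestrict (hUbij.toPartialEquiv k U _)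
      (hc.mono (inter_subset_left.trans hbb)) hom hUo
  refine ⟨K, h0U, inter_subset_left.trans hbb, hk0', fun z hz hz0 => ?_⟩
  have hzD : z ∈ ball 0 ρ \ {0} := ⟨hbb hz.1, hz0⟩
  have hzs := hκ.mem_source z hzD
  have hKk : AnalyticAt ℂ (K ∘ (κ z).symm) (κ z z) := hk z hzD
  refine ⟨hKk, ?_⟩
  have hd : deriv (K ∘ (κ z).symm) (κ z z) ≠ 0 := hder z hz hz0
  have h1 := ((κ z).symm.trans K).analyticAt_symm' (𝕜 := ℂ) (a := κ z z)
    (i := ContinuousLinearEquiv.unitsEquivAut ℂ (Units.mk0 _ hd)) (by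
      rw [OpenPartialHomeomorph.trans_source]
      exact ⟨(κ z).map_source hzs, by rw [mem_preimage, (κ z).left_inv hzs]; exact hz⟩) hKk (by
      ext
      simp)
  simpa [(κ z).left_inv hzs] using h1

/-! ### The maximum principle and parabolicity -/

theorem MDifferentiable.analyticOnNhd_comp_symm {M : Type*} [TopologicalSpace M] [ChartedSpace ℂ M]
    [IsManifold 𝓘(ℂ) ω M] {f : M → ℂ} (hf : MDifferentiable 𝓘(ℂ) 𝓘(ℂ) f)
    {e : OpenPartialHomeomorph M ℂ} (he : e ∈ atlas ℂ M) :
    AnalyticOnNhd ℂ (f ∘ e.symm) e.target := by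
  have : IsManifold 𝓘(ℂ) 1 M := .of_le (n := ω) le_top
  have h1 : MDifferentiableOn 𝓘(ℂ) 𝓘(ℂ) (f ∘ e.symm) e.target :=
    hf.comp_mdifferentiableOn (mdifferentiableOn_atlas_symm he)
  exact h1.differentiableOn.analyticOnNhd e.open_target

/-- Local strong maximum principle: a subharmonic function that lies below a function with the mean
value property and touches it at the centre of a disc agrees with it on the disc. -/
theorem IsSubharmonic.eq_of_le_of_eq {M : Type*} [TopologicalSpace M] [ChartedSpace ℂ M]
    {u : M → EReal} (hu : IsSubharmonic u) {e : OpenPartialHomeomorph M ℂ} (he : e ∈ atlas ℂ M)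
    {c : ℂ} {r₀ : ℝ} (hr : closedBall c r₀ ⊆ e.target) {φ : ℂ → ℝ}
    (hφ : ContinuousOn φ (closedBall c r₀))
    (hmean : ∀ r, 0 < r → r ≤ r₀ → Real.circleAverage φ c r = φ c)
    (hle : ∀ z ∈ closedBall c r₀, u (e.symm z) ≤ (φ z : EReal))
    (hc : u (e.symm c) = (φ c : EReal)) {z : ℂ} (hz : z ∈ closedBall c r₀) :
    u (e.symm z) = (φ z : EReal) := by
  refine le_antisymm (hle z hz) ?_
  by_contra! hlt
  set r := dist z c with hrdef
  have hr0 : 0 < r := by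
    rw [hrdef, dist_pos]
    rintro rfl
    exact hlt.ne hc
  have hrr : r ≤ r₀ := hz
  obtain ⟨t, ht1, ht2⟩ := EReal.lt_iff_exists_real_btwn.1 hlt
  rw [EReal.coe_lt_coe_iff] at ht2
  have hsph : sphere c r ⊆ closedBall c r₀ :=
    sphere_subset_closedBall.trans (closedBall_subset_closedBall hrr)
  have hzs : z ∈ sphere c r := rfl
  -- Near `z`, `u` lies below `t` and `φ` above `t + η`.
  have hut : ∀ᶠ x in 𝓝 z, u (e.symm x) < t :=
    (e.continuousAt_symm (hr hz)).eventually (hu.1 (e.symm z) t ht1)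
  set η := (φ z - t) / 2 with hη
  have hη0 : 0 < η := by rw [hη]; linarith
  have hφt : ∀ᶠ x in 𝓝[sphere c r] z, t + η < φ x := by
    have h1 : ContinuousWithinAt φ (sphere c r) z := (hφ.mono hsph) z hzs
    exact h1.eventually_const_lt (by rw [hη]; linarith)
  obtain ⟨δ₁, hδ₁, h1⟩ := Metric.eventually_nhds_iff_ball.1 hut
  obtain ⟨δ₂, hδ₂, h2⟩ := Metric.eventually_nhds_iff_ball.1 (eventually_nhdsWithin_iff.1 hφt)
  set δ := min δ₁ δ₂ with hδ
  have hδ0 : 0 < δ := lt_min hδ₁ hδ₂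
  set ψ : ℂ → ℝ := fun x => φ x - η * max 0 (1 - dist x z / δ) with hψ
  have hψc : ContinuousOn ψ (sphere c r) := by
    refine (hφ.mono hsph).sub (Continuous.continuousOn ?_)
    fun_prop
  have hψu : ∀ x ∈ sphere c r, u (e.symm x) ≤ (ψ x : EReal) := by
    intro x hx
    by_cases hxz : dist x z < δ
    · refine (h1 x (hxz.trans_le (min_le_left _ _))).le.trans ?_
      rw [EReal.coe_le_coe_iff]
      have h3 := h2 x (hxz.trans_le (min_le_right _ _)) hx
      have h4 : max 0 (1 - dist x z / δ) ≤ 1 := by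
        refine max_le zero_le_one ?_
        have : 0 ≤ dist x z / δ := by positivity
        linarith
      have := mul_le_of_le_one_right hη0.le h4
      simp only [hψ]
      linarith
    · have h4 : max 0 (1 - dist x z / δ) = 0 := by
        refine max_eq_left ?_
        have := (one_le_div hδ0).2 (not_lt.1 hxz)
        linarith
      have h5 : ψ x = φ x := by simp [hψ, h4]
      rw [h5]
      exact hle x (hsph hx)
  have h3 := hu.2.2 e he c r hr0 ((closedBall_subset_closedBall hrr).trans hr) ψ hψc hψu
  have h4 : Real.circleAverage ψ c r < Real.circleAverage φ c r := by
    have hcm : ∀ θ, circleMap c r θ ∈ sphere c r := circleMap_mem_sphere c hr0.le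
    have hmaps : ∀ {g : ℂ → ℝ}, ContinuousOn g (sphere c r) →
        ContinuousOn (fun θ => g (circleMap c r θ)) (Icc 0 (2 * Real.pi)) := fun hg =>
      hg.comp (continuous_circleMap c r).continuousOn fun θ _ => hcm θ
    have hz' : z ∈ circleMap c r '' Ioc 0 (2 * Real.pi) := by
      rw [image_circleMap_Ioc, abs_of_pos hr0]; exact hzs
    obtain ⟨θ, hθ, hθz⟩ := hz'
    rw [Real.circleAverage, Real.circleAverage, smul_eq_mul, smul_eq_mul]
    refine mul_lt_mul_of_pos_left ?_ (by positivity)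
    refine intervalIntegral.integral_lt_integral_of_continuousOn_of_le_of_exists_lt
      (by positivity) (hmaps hψc) (hmaps (hφ.mono hsph)) (fun θ _ => ?_)
      ⟨θ, Ioc_subset_Icc_self hθ, ?_⟩
    · have : 0 ≤ η * max 0 (1 - dist (circleMap c r θ) z / δ) := by positivity
      simp only [hψ]
      linarith
    · simp [hψ, hθz, hη0]
  rw [hmean r hr0 hrr] at h4
  rw [hc, EReal.coe_le_coe_iff] at h3
  linarith

/-- The local strong maximum principle, for comparison with `m + ε * log ‖f‖`, where `f` is
holomorphic without zeros. -/
theorem IsSubharmonic.eventually_eq_log_norm {M : Type*} [TopologicalSpace M] [ChartedSpace ℂ M]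
    [IsManifold 𝓘(ℂ) ω M] {u : M → EReal} (hu : IsSubharmonic u) {f : M → ℂ}
    (hf : MDifferentiable 𝓘(ℂ) 𝓘(ℂ) f) {m ε : ℝ} {p : M}
    (hp : ∀ᶠ x in 𝓝 p, f x ≠ 0 ∧ u x ≤ ((m + ε * Real.log ‖f x‖ : ℝ) : EReal))
    (hup : u p = ((m + ε * Real.log ‖f p‖ : ℝ) : EReal)) :
    ∀ᶠ x in 𝓝 p, u x = ((m + ε * Real.log ‖f x‖ : ℝ) : EReal) := by
  set e := chartAt ℂ p with hedef
  have he : e ∈ atlas ℂ M := chart_mem_atlas ℂ p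
  have hps : p ∈ e.source := mem_chart_source ℂ p
  have hana := hf.analyticOnNhd_comp_symm he
  have hev : ∀ᶠ z in 𝓝 (e p), z ∈ e.target ∧
      (f (e.symm z) ≠ 0 ∧ u (e.symm z) ≤ ((m + ε * Real.log ‖f (e.symm z)‖ : ℝ) : EReal)) := by
    refine Filter.Eventually.and (e.open_target.mem_nhds (e.map_source hps)) ?_
    have h1 := (e.continuousAt_symm (e.map_source hps)).tendsto
    rw [e.left_inv hps] at h1
    exact h1.eventually hp
  obtain ⟨r₀, hr₀, hball⟩ := (nhds_basis_closedBall.eventually_iff).1 hev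
  have hcon : ∀ r, 0 < r → r ≤ r₀ →
      AnalyticOnNhd ℂ (f ∘ e.symm) (closedBall (e p) |r|) ∧
        ∀ z ∈ closedBall (e p) |r|, (f ∘ e.symm) z ≠ 0 := by
    intro r h0 hr
    rw [abs_of_pos h0]
    have hsub := closedBall_subset_closedBall (x := e p) hr
    exact ⟨fun z hz => hana z (hball (hsub hz)).1, fun z hz => (hball (hsub hz)).2.1⟩
  have hlogc : ContinuousOn (fun z => Real.log ‖f (e.symm z)‖) (closedBall (e p) r₀) := by
    refine ContinuousOn.log (ContinuousOn.norm ?_) fun z hz => norm_ne_zero_iff.2 (hball hz).2.1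
    exact hana.continuousOn.mono fun z hz => (hball hz).1
  have hmain := fun z hz => hu.eq_of_le_of_eq he (c := e p) (r₀ := r₀) (fun z hz => (hball hz).1)
    (φ := fun z => m + ε * Real.log ‖f (e.symm z)‖)
    (continuousOn_const.add (continuousOn_const.mul hlogc)) (by
      intro r h0 hr
      obtain ⟨h1, h2⟩ := hcon r h0 hr
      have h3 := h1.circleAverage_log_norm_of_ne_zero h2
      have hint : CircleIntegrable (fun z => Real.log ‖f (e.symm z)‖) (e p) r :=
        ContinuousOn.circleIntegrable h0.le (hlogc.mono
          (sphere_subset_closedBall.trans (closedBall_subset_closedBall hr)))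
      have h4 := Real.circleAverage_fun_add (f₁ := fun _ => m)
        (f₂ := fun z => ε • Real.log ‖f (e.symm z)‖) (circleIntegrable_const m (e p) r)
        (hint.const_smul (a := ε))
      simp only [smul_eq_mul] at h4
      rw [h4, Real.circleAverage_const]
      have h5 := Real.circleAverage_fun_smul (a := ε) (f := fun z => Real.log ‖f (e.symm z)‖)
        (c := e p) (R := r)
      simp only [smul_eq_mul] at h5
      rw [h5]
      simp only [Function.comp_apply] at h3
      rw [h3]) (fun z hz => (hball hz).2.2) (by simpa [e.left_inv hps] using hup) (z := z) hz
  have h1 := (e.continuousAt hps).eventually (closedBall_mem_nhds (e p) hr₀)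
  filter_upwards [h1, e.open_source.mem_nhds hps] with x hx hxs
  have := hmain (e x) hx
  rwa [e.left_inv hxs] at this

theorem EReal.add_neg_coe_le_iff {a : EReal} {b c : ℝ} :
    a + ((-b : ℝ) : EReal) ≤ c ↔ a ≤ ((b + c : ℝ) : EReal) := by
  induction a with
  | bot => simp
  | top => simp [-EReal.coe_neg, -EReal.coe_add]
  | coe a => norm_cast; constructor <;> intro h <;> linarith

/-- Surfaces with a proper holomorphic function `f` are parabolic, because `log ‖f‖` is harmonic and
tends to infinity at the ends: comparison with `ε * log ‖f‖` shows that a negative subharmonic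
function is bounded by its maximum on a compact set, and the strong maximum principle applies. -/
theorem isParabolic_of_isProperMap {M : Type*} [TopologicalSpace M] [ConnectedSpace M]
    [NoncompactSpace M] [ChartedSpace ℂ M] [IsManifold 𝓘(ℂ) ω M] {f : M → ℂ}
    (hf : MDifferentiable 𝓘(ℂ) 𝓘(ℂ) f) (hfp : IsProperMap f) : IsParabolic M := by
  rintro ⟨u, hu, hneg, p, q, hpq⟩
  have husc := hu.1
  have hcpt : ∀ R, IsCompact {x | ‖f x‖ ≤ R} := by
    intro R
    have := hfp.isCompact_preimage (isCompact_closedBall (0 : ℂ) R)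
    simpa [preimage, closedBall] using this
  set R := ‖f p‖ + 1 with hR
  have hR0 : 0 < R := by positivity
  have hpR : ‖f p‖ ≤ R := by rw [hR]; linarith
  obtain ⟨x₀, hx₀, hmax⟩ := UpperSemicontinuousOn.exists_isMaxOn ⟨p, hpR⟩ (hcpt R)
    (husc.upperSemicontinuousOn _)
  -- Comparison with `m + ε * log (‖f‖ / R)` outside the compact set `‖f‖ ≤ R`.
  have hcomp : ∀ m : ℝ, u x₀ ≤ m → ∀ ε > 0, ∀ x,
      u x ≤ ((m + ε * (Real.log (max ‖f x‖ R) - Real.log R) : ℝ) : EReal) := by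
    intro m hm ε hε x₁
    by_contra! hx₁
    set h : M → ℝ := fun x => m + ε * (Real.log (max ‖f x‖ R) - Real.log R) with hh
    have hhc : Continuous h := by
      have h1 : Continuous fun x => Real.log (max ‖f x‖ R) :=
        (hf.continuous.norm.max continuous_const).log fun x => (lt_max_of_lt_right hR0).ne'
      exact continuous_const.add (continuous_const.mul (h1.sub continuous_const))
    set w : M → EReal := fun x => u x + ((-h x : ℝ) : EReal) with hw
    have hwsc : UpperSemicontinuous w := by
      refine husc.add' (continuous_coe_real_ereal.comp hhc.neg).upperSemicontinuous fun x => ?_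
      exact EReal.continuousAt_add (.inr (EReal.coe_ne_bot _)) (.inr (EReal.coe_ne_top _))
    set R₁ := max R (Real.exp (Real.log R + |m| / ε)) with hR₁
    have hbig : ∀ x, R₁ < ‖f x‖ → 0 ≤ h x := by
      intro x hx
      have h1 : Real.exp (Real.log R + |m| / ε) ≤ max ‖f x‖ R :=
        (le_max_right _ _).trans (hx.le.trans (le_max_left _ _))
      have h2 := (Real.le_log_iff_exp_le (lt_max_of_lt_right hR0)).2 h1
      have h3 : |m| ≤ ε * (Real.log (max ‖f x‖ R) - Real.log R) := by
        have : |m| / ε ≤ Real.log (max ‖f x‖ R) - Real.log R := by linarith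
        rw [div_le_iff₀ hε] at this
        linarith
      have := neg_abs_le m
      simp only [hh]
      linarith
    have hw0 : ∀ x, (0 : EReal) < w x → h x < 0 ∧ R < ‖f x‖ := by
      intro x hx
      have h1 : ¬ u x ≤ ((h x + 0 : ℝ) : EReal) := by
        rw [← EReal.add_neg_coe_le_iff, EReal.coe_zero]; exact not_le.2 hx
      rw [add_zero] at h1
      constructor
      · by_contra! h2
        exact h1 ((hneg x).le.trans (by exact_mod_cast h2))
      · by_contra! h2
        have h3 : h x = m := by simp [hh, max_eq_right h2]
        rw [h3] at h1
        exact h1 ((hmax h2).trans hm)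
    have hwx₁ : (0 : EReal) < w x₁ := by
      by_contra! h1
      rw [← EReal.coe_zero, EReal.add_neg_coe_le_iff, add_zero] at h1
      exact absurd hx₁ (not_lt.2 h1)
    have hE : ∀ x, (0 : EReal) < w x → ‖f x‖ ≤ R₁ := by
      intro x hx
      by_contra! h1
      exact absurd (hw0 x hx).1 (not_lt.2 (hbig x h1))
    obtain ⟨y, hy, hymax⟩ := UpperSemicontinuousOn.exists_isMaxOn ⟨x₁, hE x₁ hwx₁⟩ (hcpt R₁)
      (hwsc.upperSemicontinuousOn _)
    have hwy : (0 : EReal) < w y := hwx₁.trans_le (hymax (hE x₁ hwx₁))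
    have hle : ∀ x, w x ≤ w y := by
      intro x
      by_cases hx : (0 : EReal) < w x
      · exact hymax (hE x hx)
      · exact (not_lt.1 hx).trans hwy.le
    have hwytop : w y ≠ ⊤ := by
      have h1 := hu.2.1 y
      exact (EReal.add_lt_top h1.ne (EReal.coe_ne_top _)).ne
    obtain ⟨W, hW⟩ : ∃ W : ℝ, w y = W :=
      ⟨(w y).toReal, (EReal.coe_toReal hwytop (ne_bot_of_gt hwy)).symm⟩
    have hlin : ∀ x, R < ‖f x‖ →
        h x + W = (m - ε * Real.log R + W) + ε * Real.log ‖f x‖ := by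
      intro x hx
      simp only [hh, max_eq_left hx.le]
      ring
    have huW : ∀ x, u x ≤ ((h x + W : ℝ) : EReal) := fun x =>
      EReal.add_neg_coe_le_iff.1 ((hle x).trans_eq hW)
    have hAeq : ∀ x, (W : EReal) ≤ w x ↔ u x = ((h x + W : ℝ) : EReal) := by
      intro x
      constructor
      · intro h1
        have h2 : w x = W := le_antisymm ((hle x).trans_eq hW) h1
        refine le_antisymm (huW x) ?_
        by_contra! h3
        obtain ⟨t, ht1, ht2⟩ := EReal.lt_iff_exists_real_btwn.1 h3
        rw [EReal.coe_lt_coe_iff] at ht2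
        have h4 : w x ≤ ((t - h x : ℝ) : EReal) :=
          EReal.add_neg_coe_le_iff.2 (by simpa using ht1.le)
        rw [h2, EReal.coe_le_coe_iff] at h4
        linarith
      · intro h1
        simp only [hw]
        rw [h1]
        norm_cast
        linarith
    have hclosed : IsClosed {x | (W : EReal) ≤ w x} := hwsc.isClosed_preimage _
    have hopen : IsOpen {x | (W : EReal) ≤ w x} := by
      rw [isOpen_iff_mem_nhds]
      intro x hx
      have hxR : R < ‖f x‖ := (hw0 x ((hW ▸ hwy).trans_le hx)).2
      have hev : ∀ᶠ x' in 𝓝 x, R < ‖f x'‖ := hf.continuous.norm.continuousAt.eventually_const_lt hxR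
      have h1 := hu.eventually_eq_log_norm hf (p := x) (m := m - ε * Real.log R + W) (ε := ε) (by
        filter_upwards [hev] with x' hx'
        refine ⟨norm_pos_iff.1 (hR0.trans hx'), ?_⟩
        rw [← hlin x' hx']
        exact huW x') (by rw [← hlin x hxR]; exact (hAeq x).1 hx)
      filter_upwards [h1, hev] with x' hx' hx'R
      exact (hAeq x').2 (by rw [hlin x' hx'R]; exact hx')
    have huniv := IsClopen.eq_univ ⟨hclosed, hopen⟩ ⟨y, hW.ge⟩
    have hpm : (W : EReal) ≤ w p := by
      have : p ∈ {x | (W : EReal) ≤ w x} := by rw [huniv]; trivial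
      exact this
    exact absurd (hw0 p ((hW ▸ hwy).trans_le hpm)).2 (not_lt.2 hpR)
  have hglob : ∀ m : ℝ, u x₀ ≤ m → ∀ x, u x ≤ m := by
    intro m hm x
    by_contra! h1
    obtain ⟨t, ht1, ht2⟩ := EReal.lt_iff_exists_real_btwn.1 h1
    rw [EReal.coe_lt_coe_iff] at ht1
    set b := Real.log (max ‖f x‖ R) - Real.log R with hb
    have hb0 : 0 ≤ b := sub_nonneg.2 (Real.log_le_log hR0 (le_max_right _ _))
    have h2 := hcomp m hm ((t - m) / (b + 1)) (div_pos (sub_pos.2 ht1) (by linarith)) x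
    have h3 : m + (t - m) / (b + 1) * b ≤ t := by
      have : (t - m) / (b + 1) * b ≤ t - m := by
        rw [div_mul_eq_mul_div, div_le_iff₀ (by linarith)]
        nlinarith
      linarith
    exact absurd ht2 (not_lt.2 (h2.trans (by exact_mod_cast h3)))
  rcases eq_or_ne (u x₀) ⊥ with hbot | hbot
  · have hall : ∀ x, u x = ⊥ := fun x =>
      EReal.eq_bot_iff_forall_lt _ |>.2 fun m =>
        (hglob (m - 1) (by rw [hbot]; exact bot_le) x).trans_lt (by
          rw [EReal.coe_lt_coe_iff]; linarith)
    exact hpq (by rw [hall p, hall q])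
  · obtain ⟨m, hm⟩ : ∃ m : ℝ, u x₀ = m :=
      ⟨(u x₀).toReal, (EReal.coe_toReal (hu.2.1 x₀).ne hbot).symm⟩
    have hle := hglob m hm.le
    have hclosed : IsClosed {x | (m : EReal) ≤ u x} := husc.isClosed_preimage _
    have hopen : IsOpen {x | (m : EReal) ≤ u x} := by
      rw [isOpen_iff_mem_nhds]
      intro x hx
      have h1 := hu.eventually_eq_log_norm (f := fun _ => (1 : ℂ)) mdifferentiable_const
        (p := x) (m := m) (ε := 0) (by simpa using Filter.Eventually.of_forall hle)
        (by simpa using le_antisymm (hle x) hx)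
      filter_upwards [h1] with x' hx'
      exact (by simpa using hx' : u x' = m).ge
    have huniv := IsClopen.eq_univ ⟨hclosed, hopen⟩ ⟨x₀, hm.ge⟩
    have hall : ∀ x, u x = m := by
      intro x
      have : x ∈ {x | (m : EReal) ≤ u x} := by rw [huniv]; trivial
      exact le_antisymm (hle x) this
    exact hpq (by rw [hall p, hall q])

/-- The components of `F` are proper: if `F i` is bounded on a set, then some rotation makes
`Re (v * F j)` vanish at a given point of it while `Re (v * F i)` stays bounded. -/
theorem isProperMap_of_rotatedRealPart {M : Type*} [TopologicalSpace M] {F : M → Fin 2 → ℂ}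
    (hF : Continuous F) (hp : IsProperMap (rotatedRealPart univ F)) (i : Fin 2) :
    IsProperMap fun P => F P i := by
  have hFi : Continuous fun P => F P i := (continuous_apply i).comp hF
  refine isProperMap_iff_isCompact_preimage.2 ⟨hFi, fun {K} hK => ?_⟩
  obtain ⟨C, hC⟩ := hK.isBounded.exists_norm_le
  have hcpt := hp.isCompact_preimage (isCompact_closedBall (0 : Fin 2 → ℝ) |C|)
  refine (hcpt.image continuous_snd).of_isClosed_subset (hK.isClosed.preimage hFi) ?_
  intro P hP
  obtain ⟨v, hv⟩ : ∃ v : Circle, ((v : ℂ) * F P (1 - i)).re = 0 := by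
    by_cases h0 : F P (1 - i) = 0
    · exact ⟨1, by simp [h0]⟩
    · refine ⟨Circle.exp (Real.pi / 2 - arg (F P (1 - i))), ?_⟩
      rw [Circle.coe_exp]
      have hrot := norm_mul_exp_arg_mul_I (F P (1 - i))
      have : ((Real.pi / 2 - arg (F P (1 - i)) : ℝ) : ℂ) * I + arg (F P (1 - i)) * I =
          Real.pi / 2 * I := by push_cast; ring
      have h1 : exp (((Real.pi / 2 - arg (F P (1 - i)) : ℝ) : ℂ) * I) * F P (1 - i) =
          ‖F P (1 - i)‖ * I := by
        rw [mul_comm]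
        calc _ = (‖F P (1 - i)‖ : ℂ) * (exp (((Real.pi / 2 - arg (F P (1 - i)) : ℝ) : ℂ) * I) *
              exp (arg (F P (1 - i)) * I)) := by
              linear_combination
                (-exp (((Real.pi / 2 - arg (F P (1 - i)) : ℝ) : ℂ) * I)) * hrot
          _ = _ := by rw [← exp_add, this, exp_pi_div_two_mul_I]
      rw [h1]
      simp
  refine ⟨(⟨v, mem_univ _⟩, P), ?_, rfl⟩
  rw [mem_preimage, mem_closedBall, dist_zero_right, pi_norm_le_iff_of_nonneg (abs_nonneg C)]
  intro j
  have hj : j = i ∨ j = 1 - i := by fin_cases i <;> fin_cases j <;> simp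
  rcases hj with rfl | rfl
  · have h1 : ‖F P j‖ ≤ C := hC _ hP
    calc _ ≤ ‖(v : ℂ) * F P j‖ := Complex.abs_re_le_norm _
      _ = ‖F P j‖ := by rw [norm_mul, Circle.norm_coe, one_mul]
      _ ≤ |C| := h1.trans (le_abs_self C)
  · simp [rotatedRealPart, hv]

/-! ### Compactification -/

theorem analyticAt_chart_comp_symm {M : Type*} [TopologicalSpace M] [ChartedSpace ℂ M]
    [IsManifold 𝓘(ℂ) ω M] {e e' : OpenPartialHomeomorph M ℂ} (he : e ∈ atlas ℂ M)
    (he' : e' ∈ atlas ℂ M) {x : M} (hx : x ∈ e.source) (hx' : x ∈ e'.source) :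
    AnalyticAt ℂ (e' ∘ e.symm) (e x) := by
  have h1 : e.symm.trans e' ∈ contDiffGroupoid ω 𝓘(ℂ) :=
    StructureGroupoid.compatible _ he he'
  have h2 := (contMDiffOn_of_mem_contDiffGroupoid h1).contDiffOn
  have hmem : e x ∈ (e.symm.trans e').source := by
    rw [OpenPartialHomeomorph.trans_source]
    exact ⟨e.map_source hx, by rwa [mem_preimage, e.left_inv hx]⟩
  exact (h2.contDiffAt ((e.symm.trans e').open_source.mem_nhds hmem)).analyticAt

/-- A proper function on `M` tends to infinity at the points that are added to `M`. -/
theorem eventually_lt_norm_of_isProperMap {M S : Type*} [TopologicalSpace M] [TopologicalSpace S]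
    [T2Space S] {ι : OpenPartialHomeomorph M S} (hι : ι.source = univ) {f : M → ℂ} (hf : IsProperMap f) {q : S} (hq : q ∉ ι.target) (C : ℝ) :
    ∀ᶠ s in 𝓝 q, s ∈ ι.target → C < ‖f (ι.symm s)‖ := by
  have h1 : IsCompact (ι '' (f ⁻¹' closedBall 0 C)) :=
    (hf.isCompact_preimage (isCompact_closedBall 0 C)).image_of_continuousOn
      (ι.continuousOn.mono (by rw [hι]; exact subset_univ _))
  have h2 : q ∈ (ι '' (f ⁻¹' closedBall 0 C))ᶜ := by
    rintro ⟨x, -, rfl⟩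
    exact hq (ι.map_source (hι ▸ mem_univ x))
  filter_upwards [h1.isClosed.isOpen_compl.mem_nhds h2] with s hs hst
  by_contra! h
  exact hs ⟨ι.symm s, by simpa using h, ι.right_inv hst⟩

section Compactification

variable {M : Type*} [TopologicalSpace M] [ChartedSpace ℂ M] {S : Type*} [TopologicalSpace S]

/-- A complex chart `A` of a space `S` is compatible with the Riemann surface `M`, embedded in `S`
by `ι` as an open subset, if it is biholomorphic on the part of `M` where it is defined. -/
def IsCompatibleChart (ι : OpenPartialHomeomorph M S) (A : OpenPartialHomeomorph S ℂ) : Prop :=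
  ∀ x : M, ι x ∈ A.source →
    AnalyticAt ℂ (A ∘ ι ∘ (chartAt ℂ x).symm) (chartAt ℂ x x) ∧
      AnalyticAt ℂ (chartAt ℂ x ∘ ι.symm ∘ A.symm) (A (ι x))

theorem isCompatibleChart_symm_trans_chartAt [IsManifold 𝓘(ℂ) ω M]
    {ι : OpenPartialHomeomorph M S} (hι : ι.source = univ) (y : M) : IsCompatibleChart ι (ι.symm.trans (chartAt ℂ y)) := by
  intro x hx
  have hxs : x ∈ ι.source := hι ▸ mem_univ x
  rw [OpenPartialHomeomorph.trans_source, mem_inter_iff, mem_preimage, ι.left_inv hxs] at hx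
  have hinv : ∀ z, ι.symm (ι z) = z := fun z => ι.left_inv (hι ▸ mem_univ z)
  have hxc := mem_chart_source ℂ x
  constructor
  · have h1 := analyticAt_chart_comp_symm (chart_mem_atlas ℂ x) (chart_mem_atlas ℂ y) hxc hx.2
    convert h1 using 1
    ext z
    simp [hinv]
  · have h1 := analyticAt_chart_comp_symm (chart_mem_atlas ℂ y) (chart_mem_atlas ℂ x) hx.2 hxc
    convert h1 using 1
    · ext z
      simp [hinv]
    · simp [hinv]

/-- Holomorphic functions on `M` are holomorphic in compatible charts. -/
theorem IsCompatibleChart.analyticAt_comp {ι : OpenPartialHomeomorph M S} (hι : ι.source = univ)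
    {A : OpenPartialHomeomorph S ℂ} (hA : IsCompatibleChart ι A) {x : M} (hx : ι x ∈ A.source)
    {Y : Type*} {g : M → Y} (k : Y → ℂ)
    (hg : AnalyticAt ℂ (k ∘ g ∘ (chartAt ℂ x).symm) (chartAt ℂ x x)) :
    AnalyticAt ℂ (k ∘ g ∘ ι.symm ∘ A.symm) (A (ι x)) := by
  have hxs : x ∈ ι.source := hι ▸ mem_univ x
  have hval : (chartAt ℂ x ∘ ι.symm ∘ A.symm) (A (ι x)) = chartAt ℂ x x := by
    simp [A.left_inv hx, ι.left_inv hxs]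
  have h1 := AnalyticAt.comp (hval ▸ hg) (hA x hx).2
  refine h1.congr ?_
  have h2 : ContinuousAt (ι.symm ∘ A.symm) (A (ι x)) := by
    refine ContinuousAt.comp ?_ (A.continuousAt_symm (A.map_source hx))
    rw [A.left_inv hx]
    exact ι.continuousAt_symm (ι.map_source hxs)
  have h3 : (ι.symm ∘ A.symm) (A (ι x)) = x := by simp [A.left_inv hx, ι.left_inv hxs]
  have h4 : ∀ᶠ w in 𝓝 (A (ι x)), (ι.symm ∘ A.symm) w ∈ (chartAt ℂ x).source :=
    h2.eventually ((chartAt ℂ x).open_source.mem_nhds (by rw [h3]; exact mem_chart_source ℂ x))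
  filter_upwards [h4] with w hw
  simp only [Function.comp_apply] at hw ⊢
  rw [(chartAt ℂ x).left_inv hw]

theorem IsCompatibleChart.analyticAt_transition {ι : OpenPartialHomeomorph M S}
    (hι : ι.source = univ) {A A' : OpenPartialHomeomorph S ℂ} (hA : IsCompatibleChart ι A)
    (hA' : IsCompatibleChart ι A') {x : M} (hx : ι x ∈ A.source) (hx' : ι x ∈ A'.source) :
    AnalyticAt ℂ (A' ∘ A.symm) (A (ι x)) := by
  have hxs : x ∈ ι.source := hι ▸ mem_univ x
  have h1 := hA.analyticAt_comp hι hx (g := ι) A' (hA' x hx').1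
  refine h1.congr ?_
  have h2 : ∀ᶠ w in 𝓝 (A (ι x)), A.symm w ∈ ι.target :=
    (A.continuousAt_symm (A.map_source hx)).eventually
      (ι.open_target.mem_nhds (by rw [A.left_inv hx]; exact ι.map_source hxs))
  filter_upwards [h2] with w hw
  simp [ι.right_inv hw]

/-- The complex structure of `M` extends over an added point `q` that has a neighbourhood
homeomorphic to a disc, provided that `M` has a proper holomorphic function. -/
theorem exists_compatibleChart_at [IsManifold 𝓘(ℂ) ω M] [T2Space S]
    {ι : OpenPartialHomeomorph M S} (hι : ι.source = univ) (hfin : ι.targetᶜ.Finite) {f : M → ℂ}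
    (hf : MDifferentiable 𝓘(ℂ) 𝓘(ℂ) f) (hfp : IsProperMap f) {q : S} (hq : q ∉ ι.target)
    (E₀ : OpenPartialHomeomorph S ℂ) (hE₀ : q ∈ E₀.source) :
    ∃ A : OpenPartialHomeomorph S ℂ, q ∈ A.source ∧ IsCompatibleChart ι A ∧
      ∀ s ∈ A.source, s ∉ ι.target → s = q := by
  let E : OpenPartialHomeomorph S ℂ := E₀.transHomeomorph (Homeomorph.subRight (E₀ q))
  have hE : q ∈ E.source := hE₀
  have hEq : E q = 0 := by simp [E]
  have hEt : (0 : ℂ) ∈ E.target := hEq ▸ E.map_source hE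
  have hE0 : E.symm 0 = q := by rw [← hEq, E.left_inv hE]
  have hev : ∀ᶠ s in 𝓝 q, (s ∈ ι.target → 1 < ‖f (ι.symm s)‖) ∧ (s ∉ ι.target → s = q) := by
    refine (eventually_lt_norm_of_isProperMap hι hfp hq 1).and ?_
    have h1 : IsClosed (ι.targetᶜ \ {q}) := (hfin.subset sdiff_subset).isClosed
    filter_upwards [h1.isOpen_compl.mem_nhds (by simp)] with s hs hst
    by_contra h
    exact hs ⟨hst, h⟩
  have hEc : Tendsto E.symm (𝓝 0) (𝓝 q) := hE0 ▸ (E.continuousAt_symm hEt).tendsto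
  obtain ⟨ρ, hρ, hball⟩ := Metric.eventually_nhds_iff_ball.1
    ((hEc.eventually hev).and (E.open_target.mem_nhds hEt))
  have htgt : ∀ z ∈ ball (0 : ℂ) ρ, z ∈ E.target := fun z hz => (hball z hz).2
  have hD : ∀ z ∈ ball (0 : ℂ) ρ \ {0}, E.symm z ∈ ι.target ∧ 1 < ‖f (ι.symm (E.symm z))‖ := by
    rintro z ⟨hz, hz0⟩
    have h1 : E.symm z ∈ ι.target := by
      by_contra h
      have h2 := (hball z hz).1.2 h
      exact hz0 (by rw [mem_singleton_iff, ← E.right_inv (htgt z hz), h2, hEq])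
    exact ⟨h1, (hball z hz).1.1 h1⟩
  -- The punctured disc with the charts of `M`.
  set j : ℂ → M := fun z => ι.symm (E.symm z) with hj
  set κ : ℂ → OpenPartialHomeomorph ℂ ℂ := fun z =>
    E.symm.trans (ι.symm.trans (chartAt ℂ (j z))) with hκdef
  have hιj : ∀ z ∈ ball (0 : ℂ) ρ \ {0}, ι (j z) = E.symm z := fun z hz => ι.right_inv (hD z hz).1
  have hsrc : ∀ z ∈ ball (0 : ℂ) ρ \ {0}, ∀ z', z ∈ (κ z').source ↔
      j z ∈ (chartAt ℂ (j z')).source := by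
    intro z hz z'
    simp only [hκdef, OpenPartialHomeomorph.trans_source, mem_inter_iff, mem_preimage,
      OpenPartialHomeomorph.symm_source]
    exact ⟨fun h => h.2.2, fun h => ⟨htgt z hz.1, (hD z hz).1, h⟩⟩
  -- A function on the disc that comes from `M` is, in the chart `κ z`, the function in the chart
  -- of `M`.
  have hcongr : ∀ z, ∀ x ∈ ball (0 : ℂ) ρ \ {0}, x ∈ (κ z).source → ∀ g : M → ℂ,
      AnalyticAt ℂ (g ∘ (chartAt ℂ (j z)).symm) (chartAt ℂ (j z) (j x)) →
      AnalyticAt ℂ ((fun y => g (j y)) ∘ (κ z).symm) (κ z x) := by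
    intro z x hx hxs g hg
    have hxc := (hsrc x hx z).1 hxs
    have hval : κ z x = chartAt ℂ (j z) (j x) := rfl
    rw [hval]
    refine hg.congr ?_
    set c := chartAt ℂ (j z)
    have h1 : ∀ᶠ w in 𝓝 (c (j x)), ι (c.symm w) ∈ E.source := by
      have h2 : ContinuousAt (fun w => ι (c.symm w)) (c (j x)) := by
        refine ContinuousAt.comp ?_ (c.continuousAt_symm (c.map_source hxc))
        exact ι.continuousAt (hι ▸ mem_univ _)
      refine h2.eventually (E.open_source.mem_nhds ?_)
      simp only [c.left_inv hxc, hιj x hx]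
      exact E.map_target (htgt x hx.1)
    filter_upwards [h1] with w hw
    change g (c.symm w) = g (ι.symm (E.symm (E (ι (c.symm w)))))
    rw [E.left_inv hw, ι.left_inv (hι ▸ mem_univ _)]
  have hκ : IsHolomorphicAtlas (ball 0 ρ \ {0}) κ := by
    constructor
    · intro z hz
      exact (hsrc z hz z).2 (mem_chart_source ℂ (j z))
    · intro z hz z' hz' x hx hxz hxz'
      refine hcongr z x hx hxz (chartAt ℂ (j z')) ?_
      exact analyticAt_chart_comp_symm (chart_mem_atlas ℂ _) (chart_mem_atlas ℂ _)
        ((hsrc x hx z).1 hxz) ((hsrc x hx z').1 hxz')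
  set h : ℂ → ℂ := fun z => if z = 0 then 0 else (f (j z))⁻¹ with hh
  have hDo : IsOpen (ball (0 : ℂ) ρ \ {0}) := isOpen_ball.sdiff isClosed_singleton
  have hhD : ∀ z ∈ ball (0 : ℂ) ρ \ {0}, h z = (f (j z))⁻¹ := by
    rintro z ⟨-, hz⟩
    rw [mem_singleton_iff] at hz
    simp [hh, hz]
  have hfne : ∀ z ∈ ball (0 : ℂ) ρ \ {0}, f (j z) ≠ 0 := fun z hz =>
    norm_pos_iff.1 (one_pos.trans (hD z hz).2)
  have hhol : HolomorphicInCharts κ (ball 0 ρ \ {0}) h := by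
    intro z hz
    have hzs := hκ.mem_source z hz
    have hzc := (hsrc z hz z).1 hzs
    have h1 := hcongr z z hz hzs (fun x => (f x)⁻¹) (by
      refine AnalyticAt.inv (hf.analyticOnNhd_comp_symm (chart_mem_atlas ℂ (j z)) _
        ((chartAt ℂ (j z)).map_source hzc)) ?_
      simpa [(chartAt ℂ (j z)).left_inv hzc] using hfne z hz)
    refine h1.congr ?_
    have h2 : ∀ᶠ x in 𝓝 z, (f (j x))⁻¹ = h x := by
      filter_upwards [hDo.mem_nhds hz] with x hx
      exact (hhD x hx).symm
    exact (OpenPartialHomeomorph.eventually_comp_symm_iff hzs).2 h2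
  have hh0 : h 0 = 0 := by simp [hh]
  have hhc : ContinuousAt h 0 := by
    rw [ContinuousAt, hh0, Metric.tendsto_nhds]
    intro ε hε
    filter_upwards [hEc.eventually (eventually_lt_norm_of_isProperMap hι hfp hq ε⁻¹),
      ball_mem_nhds (0 : ℂ) hρ] with z hz hzb
    rw [dist_zero_right]
    by_cases hz0 : z = 0
    · rw [hz0, hh0, norm_zero]; exact hε
    · rw [hhD z ⟨hzb, hz0⟩, norm_inv]
      exact inv_lt_of_inv_lt₀ hε (hz (hD z ⟨hzb, hz0⟩).1)
  obtain ⟨K, hK0, hKb, -, hK⟩ := hhol.exists_chart_at_puncture hρ hκ hhc hh0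
    (fun z hz => by rw [hhD z hz]; exact inv_ne_zero (hfne z hz))
  refine ⟨E.trans K, ?_, ?_, ?_⟩
  · rw [OpenPartialHomeomorph.trans_source]
    exact ⟨hE, by rwa [mem_preimage, hEq]⟩
  · intro x hx
    rw [OpenPartialHomeomorph.trans_source] at hx
    obtain ⟨hxE, hxK⟩ := hx
    rw [mem_preimage] at hxK
    have hxs : x ∈ ι.source := hι ▸ mem_univ x
    have hjx : j (E (ι x)) = x := by
      simp only [hj]
      rw [E.left_inv hxE, ι.left_inv hxs]
    have hx0 : E (ι x) ≠ 0 := by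
      intro h0
      rw [← hEq] at h0
      exact hq (E.injOn hxE hE h0 ▸ ι.map_source hxs)
    obtain ⟨h1, h2⟩ := hK _ hxK hx0
    have h3 : κ (E (ι x)) = E.symm.trans (ι.symm.trans (chartAt ℂ x)) := by
      simp only [hκdef, hjx]
    rw [h3] at h1 h2
    have h4 : (E.symm.trans (ι.symm.trans (chartAt ℂ x))) (E (ι x)) = chartAt ℂ x x := by
      simp [E.left_inv hxE, ι.left_inv hxs]
    rw [h4] at h1
    exact ⟨h1, h2⟩
  · intro s hs hst
    rw [OpenPartialHomeomorph.trans_source] at hs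
    have h1 := (hball (E s) (hKb hs.2)).1.2
    rw [E.left_inv hs.1] at h1
    exact h1 hst

theorem meromorphicAt_of_tendsto_norm_atTop {g : ℂ → ℂ} {c : ℂ}
    (hd : ∀ᶠ w in 𝓝[≠] c, AnalyticAt ℂ g w)
    (ht : Tendsto (fun w => ‖g w‖) (𝓝[≠] c) atTop) : MeromorphicAt g c := by
  classical
  have hne : ∀ᶠ w in 𝓝[≠] c, g w ≠ 0 := by
    filter_upwards [ht.eventually_gt_atTop 0] with w hw
    exact norm_pos_iff.1 hw
  have hG : AnalyticAt ℂ (Function.update (fun w => (g w)⁻¹) c 0) c := by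
    refine analyticAt_of_differentiable_on_punctured_nhds_of_continuousAt ?_ ?_
    · filter_upwards [hd, hne, self_mem_nhdsWithin] with w hw hw0 hwc
      refine (hw.inv hw0).differentiableAt.congr_of_eventuallyEq ?_
      filter_upwards [isOpen_compl_singleton.mem_nhds hwc] with x hx
      exact Function.update_of_ne hx _ _
    · rw [continuousAt_update_same, tendsto_zero_iff_norm_tendsto_zero]
      simpa [Function.comp_def] using tendsto_inv_atTop_zero.comp ht
  refine hG.meromorphicAt.inv.congr ?_
  filter_upwards [self_mem_nhdsWithin] with w hw
  simp [Function.update_of_ne hw]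

/-- The charted space structure given by a family of charts, one about each point. -/
@[reducible]
def chartedSpaceOfCharts (A : S → OpenPartialHomeomorph S ℂ) (hA : ∀ s, s ∈ (A s).source) :
    ChartedSpace ℂ S where
  atlas := range A
  chartAt := A
  mem_chart_source := hA
  chart_mem_atlas := mem_range_self

theorem isManifold_chartedSpaceOfCharts {ι : OpenPartialHomeomorph M S} (hι : ι.source = univ)
    {A : S → OpenPartialHomeomorph S ℂ} (hA : ∀ s, s ∈ (A s).source)
    (hcompat : ∀ s, IsCompatibleChart ι (A s))
    (hpt : ∀ s, ∀ t ∈ (A s).source, t ∉ ι.target → t = s) :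
    @IsManifold ℂ _ ℂ _ _ ℂ _ 𝓘(ℂ) ω S _ (chartedSpaceOfCharts A hA) := by
  let _ := chartedSpaceOfCharts A hA
  refine isManifold_of_contDiffOn 𝓘(ℂ) ω S ?_
  rintro _ _ ⟨s, rfl⟩ ⟨s', rfl⟩
  simp only [modelWithCornersSelf_coe, modelWithCornersSelf_coe_symm, Function.id_comp,
    Function.comp_id, preimage_id, range_id, inter_univ]
  intro w hw
  have hw' := hw
  rw [OpenPartialHomeomorph.trans_source] at hw'
  obtain ⟨hw1, hw2⟩ := hw'
  rw [OpenPartialHomeomorph.symm_source] at hw1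
  rw [mem_preimage] at hw2
  by_cases ht : (A s).symm w ∈ ι.target
  · have hx : ι (ι.symm ((A s).symm w)) = (A s).symm w := ι.right_inv ht
    have h1 := (hcompat s).analyticAt_transition hι (hcompat s')
      (x := ι.symm ((A s).symm w)) (by rw [hx]; exact (A s).map_target hw1) (by rw [hx]; exact hw2)
    rw [hx, (A s).right_inv hw1] at h1
    exact h1.contDiffAt.contDiffWithinAt
  · -- Only the chart `A s` contains the added point `s`.
    have h1 := hpt s _ ((A s).map_target hw1) ht
    have h2 := hpt s' _ hw2 ht
    have h3 : s = s' := h1.symm.trans h2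
    subst h3
    refine contDiffWithinAt_id.congr (fun x hx => ?_) ?_
    · rw [OpenPartialHomeomorph.trans_source] at hx
      exact (A s).right_inv hx.1
    · exact (A s).right_inv hw1

theorem nhdsNE_neBot_of_chart {s : S} (E : OpenPartialHomeomorph S ℂ) (hs : s ∈ E.source) :
    (𝓝[≠] s).NeBot := by
  rw [neBot_iff]
  intro h
  have h1 : ∀ᶠ x in 𝓝 s, x = s := by
    have : ∀ᶠ x in 𝓝[≠] s, False := by rw [h]; exact eventually_bot
    rw [eventually_nhdsWithin_iff] at this
    filter_upwards [this] with x hx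
    by_contra hne
    exact hx hne
  have h2 := E.continuousAt_symm (E.map_source hs)
  rw [ContinuousAt, E.left_inv hs] at h2
  have h3 : ∀ᶠ w in 𝓝[≠] (E s), False := by
    rw [eventually_nhdsWithin_iff]
    filter_upwards [h2.eventually h1, E.open_target.mem_nhds (E.map_source hs)] with w hw hwt hne
    exact hne (by rw [mem_singleton_iff, ← hw, E.right_inv hwt])
  exact h3.exists.elim fun _ h => h

/-- A Riemann surface with a proper holomorphic function that is a topological surface with finitely
many points removed is a compact Riemann surface with these points removed, and its proper
holomorphic functions extend meromorphically. -/
theorem exists_riemannSurface_structure [IsManifold 𝓘(ℂ) ω M] [ConnectedSpace M]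
    [T2Space S] [CompactSpace S] {ι : OpenPartialHomeomorph M S} (hι : ι.source = univ) (hfin : ι.targetᶜ.Finite)
    (hE : ∀ s : S, ∃ E : OpenPartialHomeomorph S ℂ, s ∈ E.source) {f : M → ℂ}
    (hf : MDifferentiable 𝓘(ℂ) 𝓘(ℂ) f) (hfp : IsProperMap f) :
    ConnectedSpace S ∧ ∃ (_ : ChartedSpace ℂ S) (_ : IsManifold 𝓘(ℂ) ω S)
      (U : TopologicalSpace.Opens S) (Φ : M ≃ₘ^ω⟮𝓘(ℂ), 𝓘(ℂ)⟯ U), ((U : Set S)ᶜ).Finite ∧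
      ∀ g : M → ℂ, MDifferentiable 𝓘(ℂ) 𝓘(ℂ) g → IsProperMap g →
        ∃ G : S → ℂ, IsMeromorphicFun G ∧ ∀ P : M, G (Φ P) = g P := by
  classical
  have hinv : ∀ x, ι.symm (ι x) = x := fun x => ι.left_inv (hι ▸ mem_univ x)
  have htgt : ∀ x, ι x ∈ ι.target := fun x => ι.map_source (hι ▸ mem_univ x)
  have hex : ∀ s : S, ∃ A : OpenPartialHomeomorph S ℂ, s ∈ A.source ∧ IsCompatibleChart ι A ∧
      ∀ t ∈ A.source, t ∉ ι.target → t = s := by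
    intro s
    by_cases hs : s ∈ ι.target
    · refine ⟨ι.symm.trans (chartAt ℂ (ι.symm s)), ?_,
        isCompatibleChart_symm_trans_chartAt hι _, ?_⟩
      · rw [OpenPartialHomeomorph.trans_source]
        exact ⟨hs, mem_chart_source ℂ _⟩
      · intro t ht htt
        rw [OpenPartialHomeomorph.trans_source] at ht
        exact absurd ht.1 htt
    · obtain ⟨E, hEs⟩ := hE s
      exact exists_compatibleChart_at hι hfin hf hfp hs E hEs
  choose A hA hcompat hpt using hex
  have hconn : ConnectedSpace S := by
    have hne : ∀ s : S, (𝓝[≠] s).NeBot := fun s => nhdsNE_neBot_of_chart (A s) (hA s)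
    have hdense : Dense ι.target := by
      simpa using (dense_univ (X := S)).sdiff_finite hfin
    have himg : ι.target = range ι := by
      rw [← ι.image_source_eq_target, hι, image_univ]
    have hpre : IsPreconnected ι.target := by
      rw [himg]
      refine isPreconnected_range (continuous_iff_continuousAt.2 fun x => ?_)
      exact ι.continuousAt (hι ▸ mem_univ x)
    have : PreconnectedSpace S := ⟨by rw [← hdense.closure_eq]; exact hpre.closure⟩
    exact ⟨⟨ι (Classical.arbitrary M)⟩⟩
  refine ⟨hconn, ?_⟩
  let _ := chartedSpaceOfCharts A hA
  have hman : IsManifold 𝓘(ℂ) ω S := isManifold_chartedSpaceOfCharts hι hA hcompat hpt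
  have hchart : ∀ s : S, chartAt ℂ s = A s := fun s => rfl
  have hιsm : ContMDiff 𝓘(ℂ) 𝓘(ℂ) ω ι := by
    intro x
    rw [contMDiffAt_iff]
    refine ⟨ι.continuousAt (hι ▸ mem_univ x), ?_⟩
    have h1 := (hcompat (ι x) x (hA _)).1
    exact h1.contDiffAt.contDiffWithinAt
  have hsymm : ∀ x : M, ContMDiffAt 𝓘(ℂ) 𝓘(ℂ) ω ι.symm (ι x) := by
    intro x
    rw [contMDiffAt_iff]
    refine ⟨ι.continuousAt_symm (htgt x), ?_⟩
    have h1 := (hcompat (ι x) x (hA _)).2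
    rw [hinv x]
    exact h1.contDiffAt.contDiffWithinAt
  let U : TopologicalSpace.Opens S := ⟨ι.target, ι.open_target⟩
  let Φ : M ≃ₘ^ω⟮𝓘(ℂ), 𝓘(ℂ)⟯ U :=
    { toFun := fun x => ⟨ι x, htgt x⟩
      invFun := fun s => ι.symm s
      left_inv := hinv
      right_inv := fun s => Subtype.ext (ι.right_inv s.2)
      contMDiff_toFun := fun x =>
        (ChartedSpace.liftPropWithinAt_subtypeVal_comp_iff (U := U)
          (fun x => (⟨ι x, htgt x⟩ : U)) univ x).1 (hιsm x)
      contMDiff_invFun := fun s => by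
        have h1 := hsymm (ι.symm s)
        rw [ι.right_inv s.2] at h1
        exact contMDiffAt_subtype_iff.2 h1 }
  refine ⟨inferInstance, hman, U, Φ, hfin, fun g hg hgp => ⟨g ∘ ι.symm, ?_, fun P => ?_⟩⟩
  · have hana : ∀ s t, t ∈ (A s).source → t ∈ ι.target →
        AnalyticAt ℂ (g ∘ ι.symm ∘ (A s).symm) (A s t) := by
      intro s t ht htt
      have h1 : ι (ι.symm t) = t := ι.right_inv htt
      have h2 := (hcompat s).analyticAt_comp hι (x := ι.symm t) (by rwa [h1]) (g := g) id
        (hg.analyticOnNhd_comp_symm (chart_mem_atlas ℂ _) _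
          ((chartAt ℂ (ι.symm t)).map_source (mem_chart_source ℂ _)))
      rwa [h1] at h2
    intro p
    rw [hchart]
    by_cases hp : p ∈ ι.target
    · exact (hana p p (hA p) hp).meromorphicAt
    · have hpt' := (A p).map_source (hA p)
      have h1 : ∀ᶠ w in 𝓝[≠] (A p p), w ∈ (A p).target ∧ (A p).symm w ∈ ι.target := by
        filter_upwards [nhdsWithin_le_nhds ((A p).open_target.mem_nhds hpt'),
          self_mem_nhdsWithin] with w hw hwp
        refine ⟨hw, ?_⟩
        by_contra h
        have h2 := hpt p _ ((A p).map_target hw) h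
        exact hwp (by
            rw [mem_singleton_iff, ← (A p).right_inv hw]
            exact congrArg (A p) h2)
      refine meromorphicAt_of_tendsto_norm_atTop ?_ ?_
      · filter_upwards [h1] with w hw
        have h2 := hana p _ ((A p).map_target hw.1) hw.2
        rwa [(A p).right_inv hw.1] at h2
      · rw [Filter.tendsto_atTop]
        intro C
        have h2 := (A p).continuousAt_symm hpt'
        rw [ContinuousAt, (A p).left_inv (hA p)] at h2
        have h3 := (h2.eventually (eventually_lt_norm_of_isProperMap hι hgp hp C)).filter_mono
          (nhdsWithin_le_nhds (s := {A p p}ᶜ))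
        filter_upwards [h1, h3] with w hw hw'
        exact (hw' hw.2).le
  · exact congrArg g (hinv P)

end Compactification

theorem proposition4p3 {M : Type u} [TopologicalSpace M] [T2Space M] [ConnectedSpace M]
    [NoncompactSpace M] [ChartedSpace ℂ M] [IsManifold 𝓘(ℂ) ω M] :
    (∀ F : M → Fin 2 → ℂ, MDifferentiable 𝓘(ℂ) 𝓘(ℂ, Fin 2 → ℂ) F →
      IsProperMap (rotatedRealPart Set.univ F) →
        (∀ j, IsProperMap (fun P => F P j)) ∧
        IsParabolic M ∧
        (HasFiniteTopology M →
          ∃ (S : Type u) (_ : TopologicalSpace S) (_ : T2Space S) (_ : CompactSpace S)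
            (_ : ConnectedSpace S) (_ : ChartedSpace ℂ S) (_ : IsManifold 𝓘(ℂ) ω S)
            (U : TopologicalSpace.Opens S) (Φ : M ≃ₘ^ω⟮𝓘(ℂ), 𝓘(ℂ)⟯ U),
            ((U : Set S)ᶜ).Finite ∧
            ∀ j, ∃ g : S → ℂ, IsMeromorphicFun g ∧ ∀ P : M, g (Φ P) = F P j)) ∧
    (IsHyperbolic M → ¬ IsProjectorSet M Set.univ) := by
  have hcomp : ∀ {n : ℕ} {F : M → Fin n → ℂ}, MDifferentiable 𝓘(ℂ) 𝓘(ℂ, Fin n → ℂ) F →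
      ∀ j, MDifferentiable 𝓘(ℂ) 𝓘(ℂ) fun P => F P j := fun hF j =>
    (ContinuousLinearMap.proj (R := ℂ) (φ := fun _ => ℂ) j).differentiable.mdifferentiable.comp hF
  refine ⟨fun F hF hp => ?_, ?_⟩
  · have hprop := isProperMap_of_rotatedRealPart hF.continuous hp
    refine ⟨hprop, isParabolic_of_isProperMap (hcomp hF 0) (hprop 0), ?_⟩
    rintro ⟨S, _, _, _, _, Q, hQ, ⟨φ⟩⟩
    have hemb : IsOpenEmbedding fun x => (φ x : S) :=
      (hQ.isClosed.isOpen_compl.isOpenEmbedding_subtypeVal).comp φ.isOpenEmbedding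
    let ι : OpenPartialHomeomorph M S := hemb.toOpenPartialHomeomorph _
    have htgt : ι.target = Qᶜ := by
      have h1 : ι.target = range fun x => (φ x : S) := by simp [ι]
      rw [h1]
      ext s
      exact ⟨fun ⟨x, hx⟩ => hx ▸ (φ x).2, fun hs => ⟨φ.symm ⟨s, hs⟩, by simp⟩⟩
    obtain ⟨hconn, hcs, hman, U, Φ, hU, hext⟩ := exists_riemannSurface_structure (ι := ι) rfl
      (by rw [htgt, compl_compl]; exact hQ)
      (fun s => ⟨(chartAt (EuclideanSpace ℝ (Fin 2)) s).transHomeomorph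
        orthonormalBasisOneI.repr.symm.toHomeomorph, mem_chart_source _ s⟩)
      (hcomp hF 0) (hprop 0)
    exact ⟨S, inferInstance, inferInstance, inferInstance, hconn, hcs, hman, U, Φ, hU,
      fun j => hext _ (hcomp hF j) (hprop j)⟩
  · rintro hyp ⟨-, F, ⟨hF, -⟩, hp⟩
    have hc : Continuous fun P => ![F P 0, F P 1] := by
      refine continuous_pi fun j => ?_
      fin_cases j
      · exact (hcomp hF 0).continuous
      · exact (hcomp hF 1).continuous
    exact isParabolic_of_isProperMap (hcomp hF 0) (isProperMap_of_rotatedRealPart hc hp 0) hyp
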